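/- **Proposition 6.3.** Let $n,p\ge 1$, $N=np$, let $U\in\mathbb U(N)$ and let $\mathbf e=[e_1,\dots,e_p]$ be an orthonormal $p$-frame in $\mathbb C^N$ (an $N\times p$ matrix) that is cyclic for $U$ in the sense that the $N$ vectors $U^ke_j$ ($0\le k<n$, $1\le j\le p$) span $\mathbb C^N$. For $N\times p$ matrices $\mathbf f,\mathbf g$ let $\ll\mathbf f,\mathbf g\gg=(\langle f_i,g_j\rangle)_{i,j}\in\mathbb C^{p\times p}$, with $\langle\cdot,\cdot\rangle$ conjugate linear in the first argument. *Orthogonal polynomials.* Let $\Sigma=\sum_\lambda W_\lambda\delta_\lambda$, $(W_\lambda)_{ij}=\langle e_i,P_\lambda e_j\rangle$, be the spectral matrix measure of $(U,\mathbf e)$, where $\lambda$ runs over the distinct eigenvalues of $U$ and $P_\lambda$ is the orthogonal projection onto $\ker(U-\lambda)$. For $p\times p$ matrix polynomials put $\langle\langle F,G\rangle\rangle_R=\int F^\dagger\,d\Sigma\,G$ and $\langle\langle F,G\rangle\rangle_L=\int G\,d\Sigma\,F^\dagger$. For $0\le k\le n-1$ let $\varphi^R_k=\Phi^R_k\kappa^R_k$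 and $\varphi^L_k=\kappa^L_k\Phi^L_k$, where $\Phi^{R}_k$, $\Phi^L_k$ are the monic matrix polynomials of degree $k$ that are orthogonal to $z^j\mathbf 1$, $j<k$, for $\langle\langle\cdot,\cdot\rangle\rangle_R$, $\langle\langle\cdot,\cdot\rangle\rangle_L$ respectively, and $\kappa^R_k,\kappa_k^L\in\mathbb C^{p\times p}$ are such that $(\varphi^R_k)$ is right-orthonormal, $(\varphi^L_k)$ is left-orthonormal, $\kappa^R_0=\kappa^L_0=\mathbf 1$, and $(\kappa^R_k)^{-1}\kappa^R_{k+1}>0$, $\kappa^L_{k+1}(\kappa^L_k)^{-1}>0$ for $k+1\le n-1$. For $P$ of degree $k$ let $P^*(z)=z^kP(1/\bar z)^\dagger$. The Verblunsky coefficients $\boldsymbol\alpha_0,\dots,\boldsymbol\alpha_{n-1}$ are the $p\times p$ matrices with $\boldsymbol\alpha_k\boldsymbol\alpha_k^\dagger\le\mathbf 1$ and $$z\varphi^L_k-\boldsymbol\rho^L_k\varphi^L_{k+1}=\boldsymbol\alpha_k^\dagger\varphi_k^{R,*},\qquad z\varphi^R_k-\varphi^R_{k+1}\boldsymbol\rho^R_k=\varphi_k^{L,*}\boldsymbol\alpha_k^\dagger\qquad(0\le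 k\le n-2),$$ where $\boldsymbol\rho^R_k=(\mathbf 1-\boldsymbol\alpha_k\boldsymbol\alpha_k^\dagger)^{1/2}$, $\boldsymbol\rho^L_k=(\mathbf 1-\boldsymbol\alpha_k^\dagger\boldsymbol\alpha_k)^{1/2}$; for $k=n-1$ one requires $\boldsymbol\alpha_{n-1}\boldsymbol\alpha_{n-1}^\dagger=\mathbf 1$ and the same two equations in $L^2(\Sigma)$ without the term containing $\varphi_n$ (i.e. $\langle\langle D,D\rangle\rangle_L=0$, resp. $\langle\langle D,D\rangle\rangle_R=0$, for the difference $D$ of the two sides). The deformed matrix Verblunsky coefficients are $$\boldsymbol\gamma_k=\boldsymbol b_k^{-1}\boldsymbol\alpha_k^\dagger,\qquad \boldsymbol b_k=\varphi^L_k(1)\bigl(\varphi^{R,*}_k(1)\bigr)^{-1},\qquad 0\le k\le n-1.$$ *GGT matrix and reflections.* Let $\boldsymbol\varepsilon_1,\dots,\boldsymbol\varepsilon_n$ be the orthonormal basis (of $p$-frames) obtained from $\mathbf e,U\mathbf e,\dots,U^{n-1}\mathbf e$ by the block Gram–Schmidt procedure normalized as above, that is $\boldsymbol\varepsilon_k=\varphi^R_{k-1}(U)\mathbf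 e$, where $F(U)\mathbf e=\sum_jU^j\mathbf eF_j$ for $F(z)=\sum_j z^jF_j$. Let $\mathcal G$ (the block GGT matrix) be the matrix of $U$ in this basis. For $0\le r\le n-1$ write an $N\times N$ matrix $M$ as $M=\begin{pmatrix}A&B\\C&D\end{pmatrix}$ with $A$ of size $rp\times rp$, and put $\Xi_N^{rp}(M)=D+C(\mathrm I-A)^{-1}B$ (so $\Xi^0_N(M)=M$); let $\mathbf c_r(M)$ be the upper left $p\times p$ block of $\Xi_N^{rp}(M)$. Let $\hat\pi_r(M)=\mathrm I_{rp}\oplus\Xi_N^{rp}(M)$ for $0\le r\le n-1$, $\hat\pi_n(M)=\mathrm I_N$, and let $\mathcal R_k$, $1\le k\le n$, be the operator with matrix $\hat\pi_{k-1}(\mathcal G)\hat\pi_k(\mathcal G)^\dagger$ in the basis $(\boldsymbol\varepsilon_j)$. Then matrices and polynomials $\Phi^{R}_k,\Phi^L_k,\kappa^R_k,\kappa^L_k,\boldsymbol\alpha_k$ as above exist, and for every choice of them all inverses used above exist (that is, $\varphi_k^{R,*}(1)$, $\boldsymbol b_k$ and $\mathrm I-A$, for $A$ the upper left $kp\times kp$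 block of $\mathcal G$, are invertible for $0\le k\le n-1$) and $$\mathbf c_{k-1}(\mathcal G)=\ll\boldsymbol\varepsilon_k,\mathcal R_k\boldsymbol\varepsilon_k\gg=\boldsymbol\gamma_{k-1},\qquad k=1,\dots,n.$$ -/

import Mathlib

open Polynomial
open scoped Matrix MatrixOrder ComplexOrder

noncomputable section

namespace BlockGGT

/-! ## Frames and the spectral matrix measure -/

/-- The pseudo-scalar product `≪f, g≫` of two families of `p` vectors of `ℂ^N`, given as the columns
of the `N × p` matrices `f` and `g`: its `(i, j)` entry is `⟨f_i, g_j⟩`, conjugate linear in the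
first argument. -/
def pseudoInner {N p : ℕ} (f g : Matrix (Fin N) (Fin p) ℂ) : Matrix (Fin p) (Fin p) ℂ :=
  Matrix.of fun i j => ∑ a, star (f a i) * g a j

/-- `e = [e_1, …, e_p]` is a cyclic orthonormal `p`-frame of `ℂ^(np)` for `U`: it is orthonormal and
the `np` vectors `U^k e_j` with `k < n` span `ℂ^(np)` (so that they form a basis, and
`e, Ue, …, U^(n-1)e` can be orthonormalized). -/
structure IsCyclicFrame (n p : ℕ) (U : Matrix (Fin (n * p)) (Fin (n * p)) ℂ)
    (e : Matrix (Fin (n * p)) (Fin p) ℂ) : Prop where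
  orthonormal : pseudoInner e e = 1
  cyclic : Submodule.span ℂ
    (Set.range fun x : Fin n × Fin p => fun a => (U ^ (x.1 : ℕ) * e) a x.2) = ⊤

/-- A finitely supported matrix measure `∑_z W_z δ_z` on `ℂ`, given by its weights `W_z`. -/
abbrev FinMatrixMeasure (p : ℕ) := ℂ →₀ Matrix (Fin p) (Fin p) ℂ

/-- The weight at `z` of the spectral matrix measure of `(U, e)`: the matrix with entries
`⟨e_i, P_z e_j⟩`, where `P_z` is the orthogonal projection onto `ker (U - z)`. -/
def spectralWeight {N p : ℕ} (U : Matrix (Fin N) (Fin N) ℂ) (e : Matrix (Fin N) (Fin p) ℂ) (z : ℂ) :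
    Matrix (Fin p) (Fin p) ℂ :=
  Matrix.of fun i j =>
    inner ℂ (WithLp.toLp 2 (fun a => e a i) : EuclideanSpace ℂ (Fin N))
      ((Module.End.eigenspace (Matrix.toEuclideanLin U) z).starProjection
        (WithLp.toLp 2 (fun a => e a j)))

/-- The spectral matrix measure `∑_z W_z δ_z` of `(U, e)`, summed over the distinct eigenvalues `z`
of the unitary matrix `U`. -/
def spectralMeasure {N p : ℕ} (U : Matrix (Fin N) (Fin N) ℂ) (e : Matrix (Fin N) (Fin p) ℂ) :
    FinMatrixMeasure p :=
  ∑ z ∈ U.charpoly.roots.toFinset, Finsupp.single z (spectralWeight U e z)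

/-! ## Matrix orthogonal polynomials -/

/-- The value `F(z) = ∑_k z^k F_k` of a matrix polynomial at a complex number. -/
def evalAt {p : ℕ} (F : (Matrix (Fin p) (Fin p) ℂ)[X]) (z : ℂ) : Matrix (Fin p) (Fin p) ℂ :=
  F.sum fun k a => z ^ k • a

/-- `⟪⟪F, G⟫⟫_R = ∫ F(z)† dΣ(z) G(z)`. -/
def innerR {p : ℕ} (μ : FinMatrixMeasure p) (F G : (Matrix (Fin p) (Fin p) ℂ)[X]) :
    Matrix (Fin p) (Fin p) ℂ :=
  μ.sum fun z w => (evalAt F z)ᴴ * w * evalAt G z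

/-- `⟪⟪F, G⟫⟫_L = ∫ G(z) dΣ(z) F(z)†`. -/
def innerL {p : ℕ} (μ : FinMatrixMeasure p) (F G : (Matrix (Fin p) (Fin p) ℂ)[X]) :
    Matrix (Fin p) (Fin p) ℂ :=
  μ.sum fun z w => evalAt G z * w * (evalAt F z)ᴴ

/-- The reversed polynomial `F^*(z) = z^k F(1 / z̄)†` of a matrix polynomial of degree `k`. -/
def reversed {p : ℕ} (k : ℕ) (F : (Matrix (Fin p) (Fin p) ℂ)[X]) : (Matrix (Fin p) (Fin p) ℂ)[X] :=
  ∑ j ∈ Finset.range (k + 1), monomial (k - j) (F.coeff j)ᴴ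

/-- `Φ` and `κ` are the first `n` right monic orthogonal polynomials and their normalizations:
`Φ k = z^k 1 + lower order` is orthogonal to `1, …, z^(k-1)` for `⟪⟪·,·⟫⟫_R`, the polynomials
`φ_k^R = Φ_k κ_k` are right-orthonormal, `φ_0^R = 1`, and `κ_k⁻¹ κ_{k+1} > 0`. -/
structure IsRightMOPUC {p : ℕ} (μ : FinMatrixMeasure p) (n : ℕ)
    (Φ : ℕ → (Matrix (Fin p) (Fin p) ℂ)[X]) (κ : ℕ → Matrix (Fin p) (Fin p) ℂ) : Prop where
  monic : ∀ k < n, (Φ k - X ^ k).degree < (k : WithBot ℕ)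
  orthogonal : ∀ k < n, ∀ j < k, innerR μ (X ^ j) (Φ k) = 0
  orthonormal : ∀ i < n, ∀ j < n,
    innerR μ (Φ i * C (κ i)) (Φ j * C (κ j)) = if i = j then 1 else 0
  kappa_zero : κ 0 = 1
  kappa_pos : ∀ k, k + 1 < n → ((κ k)⁻¹ * κ (k + 1)).PosDef

/-- The left analogue: `φ_k^L = κ_k Φ_k` is left-orthonormal, and `κ_{k+1} κ_k⁻¹ > 0`. -/
structure IsLeftMOPUC {p : ℕ} (μ : FinMatrixMeasure p) (n : ℕ)
    (Φ : ℕ → (Matrix (Fin p) (Fin p) ℂ)[X]) (κ : ℕ → Matrix (Fin p) (Fin p) ℂ) : Prop where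
  monic : ∀ k < n, (Φ k - X ^ k).degree < (k : WithBot ℕ)
  orthogonal : ∀ k < n, ∀ j < k, innerL μ (X ^ j) (Φ k) = 0
  orthonormal : ∀ i < n, ∀ j < n,
    innerL μ (C (κ i) * Φ i) (C (κ j) * Φ j) = if i = j then 1 else 0
  kappa_zero : κ 0 = 1
  kappa_pos : ∀ k, k + 1 < n → (κ (k + 1) * (κ k)⁻¹).PosDef

/-- The defect matrix `ρ^R = (1 - α α†)^{1/2}`. -/
def rhoR {p : ℕ} (α : Matrix (Fin p) (Fin p) ℂ) : Matrix (Fin p) (Fin p) ℂ :=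
  CFC.sqrt (1 - α * αᴴ)

/-- The defect matrix `ρ^L = (1 - α† α)^{1/2}`. -/
def rhoL {p : ℕ} (α : Matrix (Fin p) (Fin p) ℂ) : Matrix (Fin p) (Fin p) ℂ :=
  CFC.sqrt (1 - αᴴ * α)

/-- `α_0, …, α_{n-1}` are the matrix Verblunsky coefficients: matrices in the closed unit ball that
satisfy the right and left Szegő recursions with the orthonormal polynomials
`φR 0, …, φR (n-1)` and `φL 0, …, φL (n-1)`. For `k = n - 1` there is no further orthonormal
polynomial: then `α_{n-1}` has zero defect and the two recursions hold in `L²(Σ)` without the term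
containing `φ_n`. -/
structure IsVerblunsky {p : ℕ} (μ : FinMatrixMeasure p) (n : ℕ)
    (φR φL : ℕ → (Matrix (Fin p) (Fin p) ℂ)[X]) (α : ℕ → Matrix (Fin p) (Fin p) ℂ) : Prop where
  mem_ball : ∀ k < n, (1 - α k * (α k)ᴴ).PosSemidef
  szegoL : ∀ k, k + 1 < n →
    X * φL k - C (rhoL (α k)) * φL (k + 1) = C (α k)ᴴ * reversed k (φR k)
  szegoR : ∀ k, k + 1 < n →
    X * φR k - φR (k + 1) * C (rhoR (α k)) = reversed k (φL k) * C (α k)ᴴ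
  last_defect : ∀ k, k + 1 = n → α k * (α k)ᴴ = 1
  last_szegoL : ∀ k, k + 1 = n →
    innerL μ (X * φL k - C (α k)ᴴ * reversed k (φR k))
      (X * φL k - C (α k)ᴴ * reversed k (φR k)) = 0
  last_szegoR : ∀ k, k + 1 = n →
    innerR μ (X * φR k - reversed k (φL k) * C (α k)ᴴ)
      (X * φR k - reversed k (φL k) * C (α k)ᴴ) = 0

/-- The matrix orthogonal polynomials of degree less than `n` of a matrix measure, with its matrix
Verblunsky coefficients `α_0, …, α_{n-1}`. (Only the indices `k < n` are meaningful.) -/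
structure SzegoSystem {p : ℕ} (μ : FinMatrixMeasure p) (n : ℕ) where
  /-- right monic orthogonal polynomials -/
  PhiR : ℕ → (Matrix (Fin p) (Fin p) ℂ)[X]
  /-- right normalizations -/
  kappaR : ℕ → Matrix (Fin p) (Fin p) ℂ
  /-- left monic orthogonal polynomials -/
  PhiL : ℕ → (Matrix (Fin p) (Fin p) ℂ)[X]
  /-- left normalizations -/
  kappaL : ℕ → Matrix (Fin p) (Fin p) ℂ
  /-- Verblunsky coefficients -/
  alpha : ℕ → Matrix (Fin p) (Fin p) ℂ
  right : IsRightMOPUC μ n PhiR kappaR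
  left : IsLeftMOPUC μ n PhiL kappaL
  verblunsky : IsVerblunsky μ n (fun k => PhiR k * C (kappaR k)) (fun k => C (kappaL k) * PhiL k)
    alpha

namespace SzegoSystem

variable {p n : ℕ} {μ : FinMatrixMeasure p} (S : SzegoSystem μ n)

/-- The right orthonormal polynomial `φ_k^R = Φ_k^R κ_k^R`. -/
def phiR (k : ℕ) : (Matrix (Fin p) (Fin p) ℂ)[X] := S.PhiR k * C (S.kappaR k)

/-- The left orthonormal polynomial `φ_k^L = κ_k^L Φ_k^L`. -/
def phiL (k : ℕ) : (Matrix (Fin p) (Fin p) ℂ)[X] := C (S.kappaL k) * S.PhiL k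

/-- `b_k = φ_k^L(1) (φ_k^{R,*}(1))⁻¹`. -/
def b (k : ℕ) : Matrix (Fin p) (Fin p) ℂ :=
  evalAt (S.phiL k) 1 * (evalAt (reversed k (S.phiR k)) 1)⁻¹

/-- The deformed matrix Verblunsky coefficient `γ_k = b_k⁻¹ α_k†`. -/
def gamma (k : ℕ) : Matrix (Fin p) (Fin p) ℂ := (S.b k)⁻¹ * (S.alpha k)ᴴ

end SzegoSystem

/-! ## The Gram-Schmidt basis and the block GGT matrix -/

/-- `F(U) e = ∑_k U^k e F_k`, where an `N × p` matrix `e` is multiplied on the right by the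
coefficients of the matrix polynomial `F`. -/
def applyFrame {N p : ℕ} (U : Matrix (Fin N) (Fin N) ℂ) (e : Matrix (Fin N) (Fin p) ℂ)
    (F : (Matrix (Fin p) (Fin p) ℂ)[X]) : Matrix (Fin N) (Fin p) ℂ :=
  F.sum fun k a => U ^ k * e * a

/-- The block Gram-Schmidt basis of `e, Ue, …, U^(n-1)e`. The `k`-th block (`k` counted from `0`) is
the frame `φ_k^R(U) e = U^k e κ_k + ∑_{j<k} U^j e A_{k,j}`: the frames are orthonormal, and the choice
of the orthonormal basis within each block is fixed by `κ_0 = 1` and `κ_k⁻¹ κ_{k+1} > 0`. -/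
def gramSchmidtFrame {n p : ℕ} (U : Matrix (Fin (n * p)) (Fin (n * p)) ℂ)
    (e : Matrix (Fin (n * p)) (Fin p) ℂ) (S : SzegoSystem (spectralMeasure U e) n) (k : Fin n) :
    Matrix (Fin (n * p)) (Fin p) ℂ :=
  applyFrame U e (S.phiR k)

/-- The `np × np` matrix whose columns are the vectors of a sequence of `n` frames. -/
def frameMatrix {n p : ℕ} (ε : Fin n → Matrix (Fin (n * p)) (Fin p) ℂ) :
    Matrix (Fin (n * p)) (Fin n × Fin p) ℂ :=
  Matrix.of fun a x => ε x.1 a x.2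

/-- The matrix of `U` in the orthonormal basis formed by the frames `ε`: its entry at
`((k, i), (l, j))` is `⟨ε_{k,i}, U ε_{l,j}⟩`. -/
def matrixInBasis {n p : ℕ} (ε : Fin n → Matrix (Fin (n * p)) (Fin p) ℂ)
    (U : Matrix (Fin (n * p)) (Fin (n * p)) ℂ) : Matrix (Fin n × Fin p) (Fin n × Fin p) ℂ :=
  (frameMatrix ε)ᴴ * U * frameMatrix ε

/-- The operator on `ℂ^(np)` whose matrix in the orthonormal basis formed by the frames `ε`
is `M`. -/
def operatorOfMatrix {n p : ℕ} (ε : Fin n → Matrix (Fin (n * p)) (Fin p) ℂ)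
    (M : Matrix (Fin n × Fin p) (Fin n × Fin p) ℂ) : Matrix (Fin (n * p)) (Fin (n * p)) ℂ :=
  frameMatrix ε * M * (frameMatrix ε)ᴴ

/-! ## Neretin's operation and the reflections

The rows and columns of an `np × np` matrix are indexed by `Fin n × Fin p`: the index `(k, i)` is the
`i`-th one of the `k`-th block. -/

/-- The indices of the first `r` blocks. -/
abbrev InFirst {n p : ℕ} (r : ℕ) (x : Fin n × Fin p) : Prop := (x.1 : ℕ) < r

/-- Neretin's operation `Ξ_N^{rp}`: with `A` the upper left block of size `rp` of
`M = [[A, B], [C, D]]`, it is `D + C (1 - A)⁻¹ B`. -/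
def neretin {n p : ℕ} (r : ℕ) (M : Matrix (Fin n × Fin p) (Fin n × Fin p) ℂ) :
    Matrix {x : Fin n × Fin p // ¬ InFirst r x} {x : Fin n × Fin p // ¬ InFirst r x} ℂ :=
  M.toBlock (fun x => ¬ InFirst r x) (fun x => ¬ InFirst r x)
    + M.toBlock (fun x => ¬ InFirst r x) (InFirst r)
      * (1 - M.toBlock (InFirst r) (InFirst r))⁻¹
      * M.toBlock (InFirst r) (fun x => ¬ InFirst r x)

/-- `c_r(M)`, the upper left `p × p` block of `Ξ_N^{rp}(M)` (with `Ξ_N^0(M) = M` for `r = 0`). -/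
def neretinBlock {n p : ℕ} (r : Fin n) (M : Matrix (Fin n × Fin p) (Fin n × Fin p) ℂ) :
    Matrix (Fin p) (Fin p) ℂ :=
  Matrix.of fun i j =>
    neretin (r : ℕ) M ⟨(r, i), lt_irrefl (r : ℕ)⟩ ⟨(r, j), lt_irrefl (r : ℕ)⟩

/-- `π̂_r(M) = I_{rp} ⊕ Ξ_N^{rp}(M)`; it is `M` for `r = 0` and the identity for `r = n`. -/
def piHat {n p : ℕ} (r : ℕ) (M : Matrix (Fin n × Fin p) (Fin n × Fin p) ℂ) :
    Matrix (Fin n × Fin p) (Fin n × Fin p) ℂ :=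
  (Matrix.fromBlocks 1 0 0 (neretin r M)).reindex
    (Equiv.sumCompl (InFirst r)) (Equiv.sumCompl (InFirst r))

/-- The reflection `R_{r+1}(M) = π̂_r(M) π̂_{r+1}(M)†`, for `r = 0, …, n - 1`. -/
def reflection {n p : ℕ} (r : ℕ) (M : Matrix (Fin n × Fin p) (Fin n × Fin p) ℂ) :
    Matrix (Fin n × Fin p) (Fin n × Fin p) ℂ :=
  piHat r M * (piHat (r + 1) M)ᴴ

end BlockGGT

end

open BlockGGT

/-! By the spectral theorem `⟪⟪F, G⟫⟫_R = (F(U)e)† G(U)e`. On the unit circle `F^*(z) = z^k F(z)†`,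
so the left product becomes the right product of the reversed polynomials. A statement about
orthogonal polynomials thus becomes one about frames. Writing `R = φ_k^R` and `Q = φ_k^{L,*}`, the
frame `R(U)e` is orthogonal to `e, …, U^(k-1)e`, and `Q(U)e` to `Ue, …, U^k e`. Existence of the
whole system follows by Gram–Schmidt on both sides, with `α_k = (U R(U)e)† Q(U)e`.

All invertibility rests on one fact. If `x = F(U)e` with `deg F < k < n` and `x†(Ux - x) = 0`, then
`Ux = x`, since `U` is unitary; hence `(z - 1)F = 0` by cyclicity, and `F = 0`
(`IsCyclicFrame.eq_zero_of_inner_eq`). This gives invertibility of `1 - A` and of `R(1)`.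

Put `W = R(1)⁻¹ Q(1)`. Then `RW - Q` vanishes at `1`, so it equals `(z - 1)q` with `deg q < k`. With
`x = q(U)e`, comparing norms in `R(U)e W + x = Q(U)e + Ux` shows that `W` is unitary
(`IsOrthoPair.unitary_eval`). Since `b_k = W†`, it follows that `γ_k = W α_k†`.

Finally, let `ε` be the frame `R(U)e` and `y = xα_k† + ε`. The Szegő recursion `Uε = T + Q(U)e
α_k†`, with `T` orthogonal to `e, …, U^k e`, gives `Uy = xα_k† + ε W α_k† + T`. So `y` and `Uy` have
the same components along the first `k` blocks, and `Ξ` sends the remaining components of `y`,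
namely `ε`, to those of `Uy`, namely `ε W α_k† + T` (`neretin_mul`). The corner of `Ξ` is therefore
`W α_k†`. -/

namespace BlockGGT

/-! ### Spectral decomposition of a unitary matrix. -/

section SpectralTheorem

variable {N : ℕ} {U : Matrix (Fin N) (Fin N) ℂ}

theorem toEuclideanLin_inner (M : Matrix (Fin N) (Fin N) ℂ) (x y : EuclideanSpace ℂ (Fin N)) :
    inner ℂ x (Matrix.toEuclideanLin M y) = inner ℂ (Matrix.toEuclideanLin Mᴴ x) y := by
  rw [Matrix.toEuclideanLin_conjTranspose_eq_adjoint, LinearMap.adjoint_inner_left]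

theorem toEuclideanLin_mul_apply (M M' : Matrix (Fin N) (Fin N) ℂ)
    (x : EuclideanSpace ℂ (Fin N)) :
    Matrix.toEuclideanLin (M * M') x = Matrix.toEuclideanLin M (Matrix.toEuclideanLin M' x) := by
  simp [Matrix.toLpLin_apply, Matrix.mulVec_mulVec]

/-- Isometry forces `|z| = 1` on a nonzero eigenvector; then multiply `z U†x = x` by the conjugate
of `z`. -/
theorem conjTranspose_apply_of_mem_eigenspace (hU : Uᴴ * U = 1) {z : ℂ}
    {x : EuclideanSpace ℂ (Fin N)}
    (hx : x ∈ Module.End.eigenspace (Matrix.toEuclideanLin U) z) :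
    Matrix.toEuclideanLin Uᴴ x = (starRingEnd ℂ) z • x := by
  rw [Module.End.mem_eigenspace_iff] at hx
  have h1 : Matrix.toEuclideanLin Uᴴ (Matrix.toEuclideanLin U x) = x := by
    rw [← toEuclideanLin_mul_apply, hU]; simp
  have h2 : z • Matrix.toEuclideanLin Uᴴ x = x := by rw [← map_smul, ← hx, h1]
  by_cases hx0 : x = 0
  · simp [hx0]
  have h3 : inner ℂ (Matrix.toEuclideanLin U x) (Matrix.toEuclideanLin U x) = inner ℂ x x := by
    rw [toEuclideanLin_inner, h1]
  rw [hx, inner_smul_left, inner_smul_right, ← mul_assoc] at h3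
  have h4 : (starRingEnd ℂ) z * z = 1 := by
    apply mul_right_cancel₀ (inner_self_ne_zero (𝕜 := ℂ).mpr hx0)
    rw [h3, one_mul]
  calc Matrix.toEuclideanLin Uᴴ x = ((starRingEnd ℂ) z * z) • Matrix.toEuclideanLin Uᴴ x := by
        rw [h4, one_smul]
    _ = _ := by rw [mul_smul, h2]

/-- `U†` preserves every eigenspace of `U`, so `U` preserves the orthogonal complement of their sum.
A nonzero complement would contain an eigenvector, orthogonal to itself. -/
theorem iSup_eigenspace_eq_top (hU : Uᴴ * U = 1) :
    ⨆ z : ℂ, Module.End.eigenspace (Matrix.toEuclideanLin U) z = ⊤ := by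
  set W := ⨆ z : ℂ, Module.End.eigenspace (Matrix.toEuclideanLin U) z with hW
  rw [← Submodule.orthogonal_eq_bot_iff]
  by_contra hne
  have hinv : ∀ y ∈ Wᗮ, Matrix.toEuclideanLin U y ∈ Wᗮ := by
    intro y hy
    rw [hW, ← Submodule.iInf_orthogonal, Submodule.mem_iInf] at hy ⊢
    intro z
    rw [Submodule.mem_orthogonal]
    intro x hx
    rw [toEuclideanLin_inner, conjTranspose_apply_of_mem_eigenspace hU hx, inner_smul_left,
      (Submodule.mem_orthogonal _ _).mp (hy z) x hx, mul_zero]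
  have : Nontrivial Wᗮ := Submodule.nontrivial_iff_ne_bot.mpr hne
  obtain ⟨c, hc⟩ := Module.End.exists_eigenvalue ((Matrix.toEuclideanLin U).restrict hinv)
  obtain ⟨v, hv⟩ := hc.exists_hasEigenvector
  have hvW : (v : EuclideanSpace ℂ (Fin N)) ∈ W := by
    refine Submodule.mem_iSup_of_mem c ?_
    rw [Module.End.mem_eigenspace_iff]
    exact congrArg Subtype.val hv.apply_eq_smul
  refine hv.2 (Subtype.ext ?_)
  exact inner_self_eq_zero (𝕜 := ℂ).mp ((Submodule.mem_orthogonal _ _).mp v.2 _ hvW)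

theorem orthogonalFamily_eigenspace (hU : Uᴴ * U = 1) :
    OrthogonalFamily ℂ (fun z => Module.End.eigenspace (Matrix.toEuclideanLin U) z)
      fun z => (Module.End.eigenspace (Matrix.toEuclideanLin U) z).subtypeₗᵢ := by
  rintro z w hzw ⟨x, hx⟩ ⟨y, hy⟩
  have h := toEuclideanLin_inner U x y
  rw [conjTranspose_apply_of_mem_eigenspace hU hx, Module.End.mem_eigenspace_iff.mp hy,
    inner_smul_left, inner_smul_right, Complex.conj_conj] at h
  exact (mul_eq_mul_right_iff.mp h).resolve_left (Ne.symm hzw)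

/-- The matrix of the orthogonal projection onto `ker (U - z)`. -/
noncomputable def eigenProj (U : Matrix (Fin N) (Fin N) ℂ) (z : ℂ) : Matrix (Fin N) (Fin N) ℂ :=
  Matrix.toEuclideanLin.symm
    (Module.End.eigenspace (Matrix.toEuclideanLin U) z).starProjection.toLinearMap

theorem toEuclideanLin_eigenProj (U : Matrix (Fin N) (Fin N) ℂ) (z : ℂ)
    (x : EuclideanSpace ℂ (Fin N)) :
    Matrix.toEuclideanLin (eigenProj U z) x
      = (Module.End.eigenspace (Matrix.toEuclideanLin U) z).starProjection x := by
  rw [eigenProj, LinearEquiv.apply_symm_apply]; rfl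

theorem matrix_ext_toEuclideanLin {M M' : Matrix (Fin N) (Fin N) ℂ}
    (h : ∀ x, Matrix.toEuclideanLin M x = Matrix.toEuclideanLin M' x) : M = M' :=
  Matrix.toEuclideanLin.injective (LinearMap.ext h)

theorem eigenProj_isHermitian (U : Matrix (Fin N) (Fin N) ℂ) (z : ℂ) :
    (eigenProj U z)ᴴ = eigenProj U z := by
  apply matrix_ext_toEuclideanLin
  intro x
  refine ext_inner_right ℂ fun y => ?_
  rw [← toEuclideanLin_inner, toEuclideanLin_eigenProj, toEuclideanLin_eigenProj,
    Submodule.inner_starProjection_left_eq_right]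

theorem eigenProj_mul_self (U : Matrix (Fin N) (Fin N) ℂ) (z : ℂ) :
    eigenProj U z * eigenProj U z = eigenProj U z := by
  apply matrix_ext_toEuclideanLin
  intro x
  rw [toEuclideanLin_mul_apply, toEuclideanLin_eigenProj, toEuclideanLin_eigenProj]
  exact Submodule.starProjection_eq_self_iff.mpr (Submodule.starProjection_apply_mem _ _)

theorem mul_eigenProj (U : Matrix (Fin N) (Fin N) ℂ) (z : ℂ) :
    U * eigenProj U z = z • eigenProj U z := by
  apply matrix_ext_toEuclideanLin
  intro x
  rw [toEuclideanLin_mul_apply, map_smul, LinearMap.smul_apply, toEuclideanLin_eigenProj]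
  exact Module.End.mem_eigenspace_iff.mp (Submodule.starProjection_apply_mem _ _)

theorem conjTranspose_mul_eigenProj (hU : Uᴴ * U = 1) (z : ℂ) :
    Uᴴ * eigenProj U z = star z • eigenProj U z := by
  apply matrix_ext_toEuclideanLin
  intro x
  rw [toEuclideanLin_mul_apply, map_smul, LinearMap.smul_apply, toEuclideanLin_eigenProj]
  exact conjTranspose_apply_of_mem_eigenspace hU (Submodule.starProjection_apply_mem _ _)

theorem eigenProj_mul (hU : Uᴴ * U = 1) (z : ℂ) :
    eigenProj U z * U = z • eigenProj U z := by
  have h := congrArg Matrix.conjTranspose (conjTranspose_mul_eigenProj hU z)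
  simpa [eigenProj_isHermitian] using h

theorem sum_eigenProj (hU : Uᴴ * U = 1) :
    ∑ z ∈ U.charpoly.roots.toFinset, eigenProj U z = 1 := by
  have htop : ⨆ z : U.charpoly.roots.toFinset,
      Module.End.eigenspace (Matrix.toEuclideanLin U) (z : ℂ) = ⊤ := by
    rw [eq_top_iff, ← iSup_eigenspace_eq_top hU, iSup_le_iff]
    intro z
    by_cases hz : z ∈ U.charpoly.roots.toFinset
    · exact le_iSup (fun z : U.charpoly.roots.toFinset =>
        Module.End.eigenspace (Matrix.toEuclideanLin U) (z : ℂ)) ⟨z, hz⟩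
    · suffices h : Module.End.eigenspace (Matrix.toEuclideanLin U) z = ⊥ by
        rw [h]; exact bot_le
      by_contra hne
      apply hz
      have h : Module.End.HasEigenvalue (Matrix.toEuclideanLin U) z := hne
      rw [Module.End.hasEigenvalue_iff_isRoot_charpoly] at h
      have hc : LinearMap.charpoly (Matrix.toEuclideanLin U) = U.charpoly := by
        rw [Matrix.toEuclideanLin, Matrix.toLpLin_eq_toLin, Matrix.charpoly_toLin]
      rw [Multiset.mem_toFinset, Polynomial.mem_roots (Matrix.charpoly_monic U).ne_zero, ← hc]
      exact h
  apply matrix_ext_toEuclideanLin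
  intro x
  rw [← Finset.sum_coe_sort, map_sum, LinearMap.sum_apply]
  simp only [toEuclideanLin_eigenProj]
  rw [OrthogonalFamily.sum_projection_of_mem_iSup
    ((orthogonalFamily_eigenspace hU).comp Subtype.val_injective) x (htop ▸ Submodule.mem_top)]
  simp

theorem spectralWeight_eq {p : ℕ} (U : Matrix (Fin N) (Fin N) ℂ) (e : Matrix (Fin N) (Fin p) ℂ)
    (z : ℂ) : spectralWeight U e z = eᴴ * eigenProj U z * e := by
  ext i j
  rw [spectralWeight, Matrix.of_apply, ← toEuclideanLin_eigenProj, Matrix.toLpLin_apply,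
    EuclideanSpace.inner_eq_star_dotProduct, Matrix.mul_assoc, Matrix.mul_apply, dotProduct]
  refine Finset.sum_congr rfl fun a _ => ?_
  simp [Matrix.mul_apply, Matrix.mulVec, dotProduct, mul_comm]

end SpectralTheorem

/-! ### Matrix polynomials acting on frames, and reversal. -/

section Frames

variable {N p : ℕ} (U : Matrix (Fin N) (Fin N) ℂ) (e : Matrix (Fin N) (Fin p) ℂ)

theorem applyFrame_eq_sum_range {F : (Matrix (Fin p) (Fin p) ℂ)[X]} {k : ℕ}
    (hF : F.degree < (k : WithBot ℕ)) :
    applyFrame U e F = ∑ j ∈ Finset.range k, U ^ j * e * F.coeff j := by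
  rw [applyFrame, Polynomial.sum_def]
  refine Finset.sum_subset ?_ ?_
  · intro j hj
    rw [Finset.mem_range]
    by_contra hk
    exact Polynomial.mem_support_iff.mp hj
      ((Polynomial.degree_lt_iff_coeff_zero F k).mp hF j (not_lt.mp hk))
  · intro j _ hj
    rw [Polynomial.notMem_support_iff.mp hj, Matrix.mul_zero]

/-- `F ↦ F(U) e` as an additive map. -/
noncomputable def applyFrameHom :
    (Matrix (Fin p) (Fin p) ℂ)[X] →+ Matrix (Fin N) (Fin p) ℂ where
  toFun := applyFrame U e
  map_zero' := Polynomial.sum_zero_index _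
  map_add' _ _ := Polynomial.sum_add_index _ _ _ (fun _ => Matrix.mul_zero _)
    fun _ _ _ => Matrix.mul_add _ _ _

theorem applyFrame_add (F G : (Matrix (Fin p) (Fin p) ℂ)[X]) :
    applyFrame U e (F + G) = applyFrame U e F + applyFrame U e G :=
  map_add (applyFrameHom U e) F G

theorem applyFrame_sub (F G : (Matrix (Fin p) (Fin p) ℂ)[X]) :
    applyFrame U e (F - G) = applyFrame U e F - applyFrame U e G :=
  map_sub (applyFrameHom U e) F G

theorem applyFrame_sum {ι : Type*} (s : Finset ι) (F : ι → (Matrix (Fin p) (Fin p) ℂ)[X]) :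
    applyFrame U e (∑ i ∈ s, F i) = ∑ i ∈ s, applyFrame U e (F i) :=
  map_sum (applyFrameHom U e) F s

theorem applyFrame_zero : applyFrame U e 0 = 0 := map_zero (applyFrameHom U e)

theorem applyFrame_monomial (k : ℕ) (a : Matrix (Fin p) (Fin p) ℂ) :
    applyFrame U e (monomial k a) = U ^ k * e * a :=
  Polynomial.sum_monomial_index _ _ (Matrix.mul_zero _)

theorem applyFrame_X_pow (k : ℕ) : applyFrame U e (X ^ k) = U ^ k * e := by
  rw [← Polynomial.monomial_one_right_eq_X_pow, applyFrame_monomial, Matrix.mul_one]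

theorem applyFrame_mul_C (F : (Matrix (Fin p) (Fin p) ℂ)[X]) (a : Matrix (Fin p) (Fin p) ℂ) :
    applyFrame U e (F * C a) = applyFrame U e F * a := by
  induction F using Polynomial.induction_on' with
  | add F G hF hG => rw [add_mul, applyFrame_add, hF, hG, applyFrame_add, Matrix.add_mul]
  | monomial k b =>
    rw [Polynomial.monomial_mul_C, applyFrame_monomial, applyFrame_monomial, Matrix.mul_assoc _ b]

theorem applyFrame_X_mul (F : (Matrix (Fin p) (Fin p) ℂ)[X]) :
    applyFrame U e (X * F) = U * applyFrame U e F := by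
  induction F using Polynomial.induction_on' with
  | add F G hF hG => rw [mul_add, applyFrame_add, hF, hG, applyFrame_add, Matrix.mul_add]
  | monomial k b =>
    rw [Polynomial.X_mul_monomial, applyFrame_monomial, applyFrame_monomial, pow_succ']
    simp only [Matrix.mul_assoc]

/-! ### Degrees -/

theorem degree_mul_C_lt {F : (Matrix (Fin p) (Fin p) ℂ)[X]} {k : ℕ}
    (hF : F.degree < (k : WithBot ℕ)) (a : Matrix (Fin p) (Fin p) ℂ) :
    (F * C a).degree < (k : WithBot ℕ) := by
  rw [Polynomial.degree_lt_iff_coeff_zero] at *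
  intro m hm
  rw [Polynomial.coeff_mul_C, hF m hm, zero_mul]

theorem degree_C_mul_lt {F : (Matrix (Fin p) (Fin p) ℂ)[X]} {k : ℕ}
    (hF : F.degree < (k : WithBot ℕ)) (a : Matrix (Fin p) (Fin p) ℂ) :
    (C a * F).degree < (k : WithBot ℕ) := by
  rw [Polynomial.degree_lt_iff_coeff_zero] at *
  intro m hm
  rw [Polynomial.coeff_C_mul, hF m hm, mul_zero]

theorem degree_X_mul_lt {F : (Matrix (Fin p) (Fin p) ℂ)[X]} {k : ℕ}
    (hF : F.degree < (k : WithBot ℕ)) : (X * F).degree < ((k + 1 : ℕ) : WithBot ℕ) := by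
  rw [Polynomial.degree_lt_iff_coeff_zero] at *
  rintro (_ | m) hm
  · omega
  · rw [Polynomial.coeff_X_mul, hF m (by omega)]

theorem degree_sub_lt_of_lt {F G : (Matrix (Fin p) (Fin p) ℂ)[X]} {k : ℕ}
    (hF : F.degree < (k : WithBot ℕ)) (hG : G.degree < (k : WithBot ℕ)) :
    (F - G).degree < (k : WithBot ℕ) :=
  (Polynomial.degree_sub_le F G).trans_lt (max_lt hF hG)

theorem degree_lt_of_coeff_eq_zero {F : (Matrix (Fin p) (Fin p) ℂ)[X]} {k : ℕ}
    (hF : F.degree < ((k + 1 : ℕ) : WithBot ℕ)) (h : F.coeff k = 0) :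
    F.degree < (k : WithBot ℕ) := by
  rw [Polynomial.degree_lt_iff_coeff_zero] at *
  intro m hm
  rcases hm.eq_or_lt with rfl | hm
  · exact h
  · exact hF m hm

theorem degree_lt_mono {F : (Matrix (Fin p) (Fin p) ℂ)[X]} {k l : ℕ}
    (hF : F.degree < (k : WithBot ℕ)) (h : k ≤ l) : F.degree < (l : WithBot ℕ) :=
  hF.trans_le (by exact_mod_cast h)

/-! ### Reversed polynomials -/

theorem coeff_reversed (k : ℕ) (F : (Matrix (Fin p) (Fin p) ℂ)[X]) (i : ℕ) :
    (reversed k F).coeff i = if i ≤ k then (F.coeff (k - i))ᴴ else 0 := by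
  rw [reversed, Polynomial.finsetSum_coeff]
  simp only [Polynomial.coeff_monomial]
  split_ifs with h
  · rw [Finset.sum_eq_single (k - i)]
    · rw [if_pos (by omega)]
    · intro j hj hji
      rw [Finset.mem_range] at hj
      rw [if_neg (by omega)]
    · intro hk
      exact absurd (Finset.mem_range.mpr (by omega)) hk
  · refine Finset.sum_eq_zero fun j _ => if_neg (by omega)

theorem degree_reversed_lt (k : ℕ) (F : (Matrix (Fin p) (Fin p) ℂ)[X]) :
    (reversed k F).degree < ((k + 1 : ℕ) : WithBot ℕ) := by
  rw [Polynomial.degree_lt_iff_coeff_zero]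
  intro m hm
  rw [coeff_reversed, if_neg (by omega)]

theorem reversed_reversed {k : ℕ} {F : (Matrix (Fin p) (Fin p) ℂ)[X]}
    (hF : F.degree < ((k + 1 : ℕ) : WithBot ℕ)) : reversed k (reversed k F) = F := by
  ext1 i
  rw [coeff_reversed]
  split_ifs with h
  · rw [coeff_reversed, if_pos (by omega), Matrix.conjTranspose_conjTranspose]
    congr 1; omega
  · exact ((Polynomial.degree_lt_iff_coeff_zero F _).mp hF i (by omega)).symm

theorem reversed_sub (k : ℕ) (F G : (Matrix (Fin p) (Fin p) ℂ)[X]) :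
    reversed k (F - G) = reversed k F - reversed k G := by
  ext1 i
  simp only [coeff_reversed, Polynomial.coeff_sub]
  split_ifs <;> simp

theorem reversed_mul_C (k : ℕ) (F : (Matrix (Fin p) (Fin p) ℂ)[X])
    (a : Matrix (Fin p) (Fin p) ℂ) : reversed k (F * C a) = C aᴴ * reversed k F := by
  ext1 i
  simp only [coeff_reversed, Polynomial.coeff_mul_C, Polynomial.coeff_C_mul]
  split_ifs <;> simp

theorem reversed_C_mul (k : ℕ) (F : (Matrix (Fin p) (Fin p) ℂ)[X])
    (a : Matrix (Fin p) (Fin p) ℂ) : reversed k (C a * F) = reversed k F * C aᴴ := by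
  ext1 i
  simp only [coeff_reversed, Polynomial.coeff_mul_C, Polynomial.coeff_C_mul]
  split_ifs <;> simp

theorem reversed_succ_X_mul (k : ℕ) (F : (Matrix (Fin p) (Fin p) ℂ)[X]) :
    reversed (k + 1) (X * F) = reversed k F := by
  ext1 i
  simp only [coeff_reversed]
  by_cases h : i ≤ k
  · rw [if_pos h, if_pos (by omega), show k + 1 - i = (k - i) + 1 by omega,
      Polynomial.coeff_X_mul]
  · rw [if_neg h]
    split_ifs with h'
    · rw [show k + 1 - i = 0 by omega, Polynomial.coeff_X_mul_zero, Matrix.conjTranspose_zero]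
    · rfl

theorem reversed_X_pow {j k : ℕ} (h : j ≤ k) :
    reversed k (X ^ j : (Matrix (Fin p) (Fin p) ℂ)[X]) = X ^ (k - j) := by
  ext1 i
  simp only [coeff_reversed, Polynomial.coeff_X_pow]
  by_cases h1 : i = k - j
  · rw [if_pos (by omega), if_pos (by omega), if_pos h1, Matrix.conjTranspose_one]
  · rw [if_neg h1]
    split_ifs with h2 h3
    · omega
    · simp
    · rfl

/-- Reversing in a degree one higher costs a factor `z`. This carries the recursion for the reversed
left polynomials to the left Szegő recursion. -/
theorem reversed_succ_reversed (k : ℕ) {F : (Matrix (Fin p) (Fin p) ℂ)[X]}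
    (hF : F.degree < ((k + 1 : ℕ) : WithBot ℕ)) :
    reversed (k + 1) (reversed k F) = X * F := by
  rw [← reversed_succ_X_mul k F, reversed_reversed (degree_X_mul_lt hF)]

/-! ### Values at one -/

theorem evalAt_one (F : (Matrix (Fin p) (Fin p) ℂ)[X]) : evalAt F 1 = F.eval 1 := by
  rw [evalAt, Polynomial.eval_eq_sum]
  simp

/-- Evaluation is not multiplicative over a noncommutative ring in general; here it is, because the
point `1` is central. -/
theorem eval_one_mul_C (F : (Matrix (Fin p) (Fin p) ℂ)[X]) (a : Matrix (Fin p) (Fin p) ℂ) :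
    (F * C a).eval 1 = F.eval 1 * a := by
  induction F using Polynomial.induction_on' with
  | add F G hF hG => rw [add_mul, Polynomial.eval_add, hF, hG, Polynomial.eval_add, add_mul]
  | monomial k b =>
    rw [Polynomial.monomial_mul_C, Polynomial.eval_monomial, Polynomial.eval_monomial]
    simp

theorem eval_one_reversed {k : ℕ} {F : (Matrix (Fin p) (Fin p) ℂ)[X]}
    (hF : F.degree < ((k + 1 : ℕ) : WithBot ℕ)) : (reversed k F).eval 1 = (F.eval 1)ᴴ := by
  have hF' : F.natDegree < k + 1 := by
    rcases eq_or_ne F 0 with rfl | h0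
    · simp
    · exact (Polynomial.natDegree_lt_iff_degree_lt h0).mpr hF
  rw [reversed, Polynomial.eval_finsetSum, Polynomial.eval_eq_sum_range' hF',
    Matrix.conjTranspose_sum]
  simp [Polynomial.eval_monomial]

/-- A matrix polynomial vanishing at `1` is divisible by `z - 1`. -/
theorem exists_eq_X_mul_sub_of_eval_one_eq_zero {k : ℕ} {F : (Matrix (Fin p) (Fin p) ℂ)[X]}
    (hF : F.degree < ((k + 1 : ℕ) : WithBot ℕ)) (h : F.eval 1 = 0) :
    ∃ q : (Matrix (Fin p) (Fin p) ℂ)[X], q.degree < (k : WithBot ℕ) ∧ F = X * q - q := by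
  have hF' : F.natDegree < k + 1 := by
    rcases eq_or_ne F 0 with rfl | h0
    · simp
    · exact (Polynomial.natDegree_lt_iff_degree_lt h0).mpr hF
  -- As the coefficients of `F` sum to zero, `F = ∑ (X^j - 1) F_j`; each `X^j - 1` is `X - 1` times
  -- a geometric sum.
  refine ⟨∑ j ∈ Finset.range (k + 1), (∑ i ∈ Finset.range j, X ^ i) * C (F.coeff j), ?_, ?_⟩
  · rw [← Polynomial.mem_degreeLT]
    refine Submodule.sum_mem _ fun j hj => ?_
    rw [Finset.sum_mul]
    refine Submodule.sum_mem _ fun i hi => ?_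
    rw [Finset.mem_range] at hi hj
    rw [Polynomial.mem_degreeLT, Polynomial.degree_lt_iff_coeff_zero]
    intro m hm
    rw [Polynomial.coeff_mul_C, Polynomial.coeff_X_pow, if_neg (by omega), zero_mul]
  · have h1 : ∑ j ∈ Finset.range (k + 1), C (F.coeff j) = 0 := by
      rw [← map_sum, ← C_0]
      congr 1
      rw [Polynomial.eval_eq_sum_range' hF'] at h
      simpa using h
    calc F = ∑ j ∈ Finset.range (k + 1), X ^ j * C (F.coeff j) := by
          refine (Polynomial.as_sum_range_C_mul_X_pow' _ hF').trans ?_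
          exact Finset.sum_congr rfl fun j _ => (Polynomial.X_pow_mul).symm
      _ = ∑ j ∈ Finset.range (k + 1), (X ^ j - 1) * C (F.coeff j) := by
          simp only [sub_mul, one_mul, Finset.sum_sub_distrib, h1, sub_zero]
      _ = _ := by
          rw [Finset.mul_sum, ← Finset.sum_sub_distrib]
          refine Finset.sum_congr rfl fun j _ => ?_
          rw [← mul_geom_sum, sub_mul, one_mul, sub_mul, mul_assoc]

end Frames

/-! ### The two matrix inner products in terms of frames. -/

section SpectralMeasure

variable {N p : ℕ} {U : Matrix (Fin N) (Fin N) ℂ} (e : Matrix (Fin N) (Fin p) ℂ)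

/-- Since `P_z U^j = z^j P_z`, one has `P_z e F(z) = P_z F(U)e`. Split `P_z = P_z P_z` in each
weight and sum the projections to the identity. -/
theorem innerR_spectralMeasure (hU : Uᴴ * U = 1) (F G : (Matrix (Fin p) (Fin p) ℂ)[X]) :
    innerR (spectralMeasure U e) F G = (applyFrame U e F)ᴴ * applyFrame U e G := by
  have key : ∀ (z : ℂ) (F : (Matrix (Fin p) (Fin p) ℂ)[X]),
      eigenProj U z * e * evalAt F z = eigenProj U z * applyFrame U e F := by
    intro z F
    have hpow : ∀ j : ℕ, eigenProj U z * U ^ j = z ^ j • eigenProj U z := by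
      intro j
      induction j with
      | zero => simp
      | succ j ih => rw [pow_succ, ← Matrix.mul_assoc, ih, Matrix.smul_mul, eigenProj_mul hU,
          smul_smul, pow_succ]
    rw [evalAt, applyFrame, Polynomial.sum_def, Polynomial.sum_def, Matrix.mul_sum, Matrix.mul_sum]
    refine Finset.sum_congr rfl fun j _ => ?_
    rw [← Matrix.mul_assoc, ← Matrix.mul_assoc, hpow]
    simp [Matrix.mul_assoc]
  rw [innerR, spectralMeasure, ← Finsupp.sum_finsetSum_index (by simp) (by simp [mul_add, add_mul])]
  calc _ = ∑ z ∈ U.charpoly.roots.toFinset,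
        (applyFrame U e F)ᴴ * eigenProj U z * applyFrame U e G := by
        refine Finset.sum_congr rfl fun z _ => ?_
        rw [Finsupp.sum_single_index (by simp), spectralWeight_eq]
        calc _ = (eigenProj U z * e * evalAt F z)ᴴ * (eigenProj U z * e * evalAt G z) := by
              conv_lhs => rw [← eigenProj_mul_self]
              simp only [Matrix.conjTranspose_mul, eigenProj_isHermitian, Matrix.mul_assoc]
          _ = _ := by
              rw [key, key, Matrix.conjTranspose_mul, eigenProj_isHermitian]
              conv_rhs => rw [← eigenProj_mul_self]
              simp only [Matrix.mul_assoc]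
    _ = _ := by rw [← Matrix.sum_mul, ← Matrix.mul_sum, sum_eigenProj hU, Matrix.mul_one]

/-- For `|z| = 1` the reversed polynomial takes the value `z^k F(z)†`, and the scalar phases `z^k`
cancel in the product. -/
theorem innerL_eq_innerR_reversed {μ : FinMatrixMeasure p} (hμ : ∀ z ∈ μ.support, star z * z = 1)
    {k : ℕ} {F G : (Matrix (Fin p) (Fin p) ℂ)[X]}
    (hF : F.degree < ((k + 1 : ℕ) : WithBot ℕ)) (hG : G.degree < ((k + 1 : ℕ) : WithBot ℕ)) :
    innerL μ F G = innerR μ (reversed k G) (reversed k F) := by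
  have key : ∀ {z : ℂ} {F : (Matrix (Fin p) (Fin p) ℂ)[X]}, star z * z = 1 →
      F.degree < ((k + 1 : ℕ) : WithBot ℕ) → evalAt (reversed k F) z = z ^ k • (evalAt F z)ᴴ := by
    intro z F hz hF
    have h : ∀ F : (Matrix (Fin p) (Fin p) ℂ)[X], F.degree < ((k + 1 : ℕ) : WithBot ℕ) →
        evalAt F z = ∑ j ∈ Finset.range (k + 1), z ^ j • F.coeff j := by
      intro F hF
      have hF' : F.natDegree < k + 1 := by
        rcases eq_or_ne F 0 with rfl | h0
        · simp
        · exact (Polynomial.natDegree_lt_iff_degree_lt h0).mpr hF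
      exact Polynomial.sum_over_range' _ (fun _ => smul_zero _) _ hF'
    rw [h _ (degree_reversed_lt k F), h _ hF, Matrix.conjTranspose_sum, Finset.smul_sum,
      ← Finset.sum_range_reflect]
    refine Finset.sum_congr rfl fun j hj => ?_
    rw [Finset.mem_range] at hj
    rw [coeff_reversed, if_pos (by omega), Matrix.conjTranspose_smul, smul_smul, star_pow,
      show k - (k + 1 - 1 - j) = j by omega]
    congr 1
    conv_rhs => rw [show k = (k + 1 - 1 - j) + j by omega, pow_add, mul_assoc, ← mul_pow,
      mul_comm z, hz, one_pow, mul_one]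
  rw [innerL, innerR]
  refine Finset.sum_congr rfl fun z hz => ?_
  have hz' := hμ z hz
  beta_reduce
  rw [key hz' hF, key hz' hG, Matrix.conjTranspose_smul, Matrix.conjTranspose_conjTranspose,
    Matrix.mul_smul, Matrix.smul_mul, Matrix.smul_mul, smul_smul, star_pow, ← mul_pow, mul_comm z,
    hz', one_pow, one_smul]

/-- `P_z = U†U P_z = |z|² P_z`, so the weight vanishes off the unit circle. -/
theorem mem_support_spectralMeasure (hU : Uᴴ * U = 1) {z : ℂ}
    (hz : z ∈ (spectralMeasure U e).support) : star z * z = 1 := by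
  by_contra hne
  apply Finsupp.mem_support_iff.mp hz
  have h0 : eigenProj U z = 0 := by
    have h1 : (star z * z) • eigenProj U z = eigenProj U z := by
      rw [mul_comm, mul_smul, ← conjTranspose_mul_eigenProj hU, ← Matrix.mul_smul, ← mul_eigenProj,
        ← Matrix.mul_assoc, hU, Matrix.one_mul]
    have h2 : (star z * z - 1) • eigenProj U z = 0 := by rw [sub_smul, h1, one_smul, sub_self]
    exact (smul_eq_zero.mp h2).resolve_left (sub_ne_zero.mpr hne)
  rw [spectralMeasure, Finsupp.finsetSum_apply]
  refine Finset.sum_eq_zero fun w _ => ?_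
  rw [Finsupp.single_apply]
  split_ifs with h
  · rw [h, spectralWeight_eq, h0]; simp
  · rfl

theorem innerL_spectralMeasure (hU : Uᴴ * U = 1) {k : ℕ}
    {F G : (Matrix (Fin p) (Fin p) ℂ)[X]}
    (hF : F.degree < ((k + 1 : ℕ) : WithBot ℕ)) (hG : G.degree < ((k + 1 : ℕ) : WithBot ℕ)) :
    innerL (spectralMeasure U e) F G
      = (applyFrame U e (reversed k G))ᴴ * applyFrame U e (reversed k F) := by
  rw [innerL_eq_innerR_reversed (fun z hz => mem_support_spectralMeasure e hU hz) hF hG,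
    innerR_spectralMeasure e hU]

end SpectralMeasure

theorem isUnit_of_mul_eq_zero {m : Type*} [Fintype m] [DecidableEq m] {M : Matrix m m ℂ}
    (h : ∀ w : Matrix m m ℂ, M * w = 0 → w = 0) : IsUnit M := by
  rw [← Matrix.mulVec_injective_iff_isUnit, ← Matrix.isLeftRegular_iff_mulVec_injective,
    isLeftRegular_iff_right_eq_zero_of_mul]
  exact h

theorem isUnit_of_left_inv {m : Type*} [Fintype m] [DecidableEq m] {M M' : Matrix m m ℂ}
    (h : M' * M = 1) : IsUnit M :=
  isUnit_of_mul_eq_zero fun w hw => by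
    rw [← Matrix.one_mul w, ← h, Matrix.mul_assoc, hw, Matrix.mul_zero]

/-! ### Orthogonality to Krylov spaces. -/

section Krylov

variable {N p : ℕ} {U : Matrix (Fin N) (Fin N) ℂ} {e : Matrix (Fin N) (Fin p) ℂ}

theorem applyFrame_orthogonal {k : ℕ} {g : Matrix (Fin N) (Fin p) ℂ}
    (hg : ∀ j < k, (U ^ j * e)ᴴ * g = 0) {F : (Matrix (Fin p) (Fin p) ℂ)[X]}
    (hF : F.degree < (k : WithBot ℕ)) : (applyFrame U e F)ᴴ * g = 0 := by
  rw [applyFrame_eq_sum_range U e hF, Matrix.conjTranspose_sum, Matrix.sum_mul]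
  refine Finset.sum_eq_zero fun j hj => ?_
  rw [Matrix.conjTranspose_mul, Matrix.mul_assoc, hg j (Finset.mem_range.mp hj), Matrix.mul_zero]

/-- Only the constant term survives. When `F(0)` is invertible, orthogonality of `g` to `F(U)e` thus
yields the missing orthogonality to `e`; the primed version does the same with the top coefficient
and `U^k e`. -/
theorem applyFrame_conjTranspose_mul_of_orthogonal {k : ℕ} {g : Matrix (Fin N) (Fin p) ℂ}
    (hg : ∀ j < k, (U ^ (j + 1) * e)ᴴ * g = 0) {F : (Matrix (Fin p) (Fin p) ℂ)[X]}
    (hF : F.degree < ((k + 1 : ℕ) : WithBot ℕ)) :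
    (applyFrame U e F)ᴴ * g = (F.coeff 0)ᴴ * (eᴴ * g) := by
  rw [applyFrame_eq_sum_range U e hF, Finset.sum_range_succ', Matrix.conjTranspose_add,
    Matrix.add_mul, Matrix.conjTranspose_sum, Matrix.sum_mul, Finset.sum_eq_zero, zero_add]
  · simp [Matrix.mul_assoc]
  · intro j hj
    rw [Matrix.conjTranspose_mul, Matrix.mul_assoc, hg j (Finset.mem_range.mp hj), Matrix.mul_zero]

theorem applyFrame_conjTranspose_mul_of_orthogonal' {k : ℕ} {g : Matrix (Fin N) (Fin p) ℂ}
    (hg : ∀ j < k, (U ^ j * e)ᴴ * g = 0) {F : (Matrix (Fin p) (Fin p) ℂ)[X]}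
    (hF : F.degree < ((k + 1 : ℕ) : WithBot ℕ)) :
    (applyFrame U e F)ᴴ * g = (F.coeff k)ᴴ * ((U ^ k * e)ᴴ * g) := by
  rw [applyFrame_eq_sum_range U e hF, Finset.sum_range_succ, Matrix.conjTranspose_add,
    Matrix.add_mul, Matrix.conjTranspose_sum, Matrix.sum_mul, Finset.sum_eq_zero, zero_add]
  · rw [Matrix.conjTranspose_mul _ (F.coeff k), Matrix.mul_assoc]
  · intro j hj
    rw [Matrix.conjTranspose_mul, Matrix.mul_assoc, hg j (Finset.mem_range.mp hj), Matrix.mul_zero]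

theorem conjTranspose_mul_cancel (hU : Uᴴ * U = 1) (f g : Matrix (Fin N) (Fin p) ℂ) :
    (U * f)ᴴ * (U * g) = fᴴ * g := by
  rw [Matrix.conjTranspose_mul, Matrix.mul_assoc, ← Matrix.mul_assoc Uᴴ, hU, Matrix.one_mul]

/-- The equality case of Cauchy–Schwarz: expanding `(Ux - x)†(Ux - x)` with `U†U = 1` leaves only
terms that cancel. -/
theorem mul_eq_self_of_inner_eq (hU : Uᴴ * U = 1) {x : Matrix (Fin N) (Fin p) ℂ}
    (hx : xᴴ * (U * x - x) = 0) : U * x - x = 0 := by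
  rw [← Matrix.conjTranspose_mul_self_eq_zero]
  have h1 : xᴴ * (U * x) = xᴴ * x := by rwa [Matrix.mul_sub, sub_eq_zero] at hx
  have h2 : (U * x)ᴴ * x = xᴴ * x := by
    have := congrArg Matrix.conjTranspose h1
    simpa only [Matrix.conjTranspose_mul, Matrix.conjTranspose_conjTranspose] using this
  rw [Matrix.conjTranspose_sub, Matrix.sub_mul, hx, sub_zero, Matrix.mul_sub, h2,
    conjTranspose_mul_cancel hU, sub_self]

end Krylov

/-! ### Consequences of cyclicity. -/

section CyclicFrame

variable {n p : ℕ} {U : Matrix (Fin (n * p)) (Fin (n * p)) ℂ} {e : Matrix (Fin (n * p)) (Fin p) ℂ}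

/-- The `np` spanning vectors live in dimension `np`, hence are linearly independent. -/
theorem IsCyclicFrame.eq_zero_of_applyFrame_eq_zero (he : IsCyclicFrame n p U e)
    {F : (Matrix (Fin p) (Fin p) ℂ)[X]} (hF : F.degree < (n : WithBot ℕ))
    (h : applyFrame U e F = 0) : F = 0 := by
  have hli : LinearIndependent ℂ fun x : Fin n × Fin p => fun a => (U ^ (x.1 : ℕ) * e) a x.2 :=
    linearIndependent_of_top_le_span_of_card_eq_finrank he.cyclic.ge (by simp)
  rw [Fintype.linearIndependent_iff] at hli
  ext j i v
  rcases lt_or_ge j n with hj | hj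
  · have := hli (fun x => F.coeff x.1 x.2 v) ?_ (⟨j, hj⟩, i)
    · simpa using this
    · ext a
      have h1 := congrFun (congrFun h a) v
      rw [applyFrame_eq_sum_range U e hF, Matrix.sum_apply, Finset.sum_range] at h1
      simp only [Matrix.mul_apply (M := U ^ _ * e), Matrix.zero_apply] at h1
      rw [Fintype.sum_prod_type]
      simp only [Finset.sum_apply, Pi.smul_apply, smul_eq_mul, Pi.zero_apply]
      rw [← h1]
      exact Finset.sum_congr rfl fun _ _ => Finset.sum_congr rfl fun _ _ => mul_comm _ _
  · rw [(Polynomial.degree_lt_iff_coeff_zero F n).mp hF j hj]; simp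

theorem IsCyclicFrame.eq_zero_of_orthogonal (he : IsCyclicFrame n p U e)
    {D : Matrix (Fin (n * p)) (Fin p) ℂ} (h : ∀ j < n, (U ^ j * e)ᴴ * D = 0) : D = 0 := by
  ext a v
  have key : ∀ x ∈ Submodule.span ℂ
      (Set.range fun x : Fin n × Fin p => fun a => (U ^ (x.1 : ℕ) * e) a x.2),
      ∑ a, star (D a v) * x a = 0 := by
    intro x hx
    induction hx using Submodule.span_induction with
    | mem x hx =>
      obtain ⟨⟨j, i⟩, rfl⟩ := hx
      have h1 := congrArg star (congrFun (congrFun (h j j.2) i) v)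
      rw [Matrix.mul_apply, Matrix.zero_apply, star_zero, star_sum] at h1
      rw [← h1]
      exact Finset.sum_congr rfl fun a _ => by rw [star_mul, Matrix.conjTranspose_apply, star_star]
    | zero => simp
    | add x y _ _ hx hy => simp only [Pi.add_apply, mul_add, Finset.sum_add_distrib, hx, hy, add_zero]
    | smul c x _ hx =>
      simp only [Pi.smul_apply, smul_eq_mul, mul_left_comm _ c, ← Finset.mul_sum, hx, mul_zero]
  have h0 := key (Pi.single a 1) (he.cyclic ▸ Submodule.mem_top)
  simpa [Pi.single_apply] using h0

/-- The compression of `U` to a proper Krylov space does not have eigenvalue `1`: a fixed vector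
would be fixed by `U` itself, and `(z - 1)F` still has degree less than `n`, so it is zero; `z - 1`
is monic. -/
theorem IsCyclicFrame.eq_zero_of_inner_eq (he : IsCyclicFrame n p U e) (hU : Uᴴ * U = 1)
    {k : ℕ} (hk : k < n) {F : (Matrix (Fin p) (Fin p) ℂ)[X]} (hF : F.degree < (k : WithBot ℕ))
    (h : (applyFrame U e F)ᴴ * (U * applyFrame U e F - applyFrame U e F) = 0) : F = 0 := by
  have h1 := mul_eq_self_of_inner_eq hU h
  rw [← applyFrame_X_mul, ← applyFrame_sub] at h1
  have h2 := he.eq_zero_of_applyFrame_eq_zero (degree_lt_mono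
    (degree_sub_lt_of_lt (degree_X_mul_lt hF) (degree_lt_mono hF k.le_succ)) hk) h1
  have h3 : (X - C 1) * F = 0 := by rwa [C_1, sub_mul, one_mul]
  exact ((Polynomial.monic_X_sub_C 1).mul_right_eq_zero_iff).mp h3

/-- Projection onto the span of `e, Ue, …, U^(k-1)e`. -/
theorem IsCyclicFrame.exists_add_orthogonal (he : IsCyclicFrame n p U e) {k : ℕ} (hk : k ≤ n)
    (g : Matrix (Fin (n * p)) (Fin p) ℂ) :
    ∃ F : (Matrix (Fin p) (Fin p) ℂ)[X], F.degree < (k : WithBot ℕ) ∧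
      ∀ j < k, (U ^ j * e)ᴴ * (g + applyFrame U e F) = 0 := by
  let P : (Fin k → Matrix (Fin p) (Fin p) ℂ) → (Matrix (Fin p) (Fin p) ℂ)[X] :=
    fun c => ∑ i : Fin k, monomial (i : ℕ) (c i)
  have hP : ∀ c, (P c).degree < (k : WithBot ℕ) := by
    intro c
    rw [← Polynomial.mem_degreeLT]
    refine Submodule.sum_mem _ fun i _ => ?_
    rw [Polynomial.mem_degreeLT]
    exact (Polynomial.degree_monomial_le _ _).trans_lt (by exact_mod_cast i.2)
  have hPcoeff : ∀ c (i : Fin k), (P c).coeff i = c i := by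
    intro c i
    simp only [P, Polynomial.finsetSum_coeff, Polynomial.coeff_monomial, Fin.val_inj]
    simp
  have happ : ∀ c, applyFrame U e (P c) = ∑ i : Fin k, U ^ (i : ℕ) * e * c i := by
    intro c
    simp only [P, applyFrame_sum, applyFrame_monomial]
  -- The block Gram operator. A kernel element gives a frame orthogonal to itself, so `T` is
  -- injective and, by finite dimension, surjective.
  let T : (Fin k → Matrix (Fin p) (Fin p) ℂ) →ₗ[ℂ] (Fin k → Matrix (Fin p) (Fin p) ℂ) :=
    { toFun := fun c j => (U ^ (j : ℕ) * e)ᴴ * applyFrame U e (P c)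
      map_add' := fun c d => by
        funext j
        simp only [happ, Pi.add_apply, Matrix.mul_add, Finset.sum_add_distrib]
      map_smul' := fun a c => by
        funext j
        simp only [happ, Pi.smul_apply, Matrix.mul_smul, ← Finset.smul_sum, RingHom.id_apply] }
  have hT : Function.Injective T := by
    rw [← LinearMap.ker_eq_bot, LinearMap.ker_eq_bot']
    intro c hc
    have h0 : applyFrame U e (P c) = 0 := by
      rw [← Matrix.conjTranspose_mul_self_eq_zero]
      exact applyFrame_orthogonal (fun j hj => congrFun hc ⟨j, hj⟩) (hP c)
    have h1 := he.eq_zero_of_applyFrame_eq_zero (degree_lt_mono (hP c) hk) h0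
    funext i
    rw [← hPcoeff c i, h1]; rfl
  obtain ⟨c, hc⟩ := (LinearMap.injective_iff_surjective.mp hT) fun j => -((U ^ (j : ℕ) * e)ᴴ * g)
  refine ⟨P c, hP c, fun j hj => ?_⟩
  have h2 : (U ^ j * e)ᴴ * applyFrame U e (P c) = -((U ^ j * e)ᴴ * g) := congrFun hc ⟨j, hj⟩
  rw [Matrix.mul_add, h2, add_neg_cancel]

end CyclicFrame

/-- The normalizations of a sequence of monic orthogonal polynomials with squared norms `A k`. -/
theorem exists_normalization {p : ℕ} (n : ℕ) (A : ℕ → Matrix (Fin p) (Fin p) ℂ) (h0 : A 0 = 1)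
    (hA : ∀ k < n, (A k).PosDef) :
    ∃ κ : ℕ → Matrix (Fin p) (Fin p) ℂ, κ 0 = 1 ∧
      (∀ k < n, IsUnit (κ k) ∧ (κ k)ᴴ * A k * κ k = 1) ∧
      ∀ k, k + 1 < n → ((κ k)⁻¹ * κ (k + 1)).PosDef := by
  -- With `κ_{k+1} = κ_k h`, the normalization reads `h† (κ_k† A_{k+1} κ_k) h = 1`; its positive
  -- solution is the inverse square root.
  let κ : ℕ → Matrix (Fin p) (Fin p) ℂ :=
    fun k => Nat.rec 1 (fun k c => c * (CFC.sqrt (cᴴ * A (k + 1) * c))⁻¹) k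
  have hsucc : ∀ k, κ (k + 1) = κ k * (CFC.sqrt ((κ k)ᴴ * A (k + 1) * κ k))⁻¹ := fun _ => rfl
  have step : ∀ k, k + 1 < n → IsUnit (κ k) →
      (CFC.sqrt ((κ k)ᴴ * A (k + 1) * κ k)).PosDef ∧
      CFC.sqrt ((κ k)ᴴ * A (k + 1) * κ k) * CFC.sqrt ((κ k)ᴴ * A (k + 1) * κ k)
        = (κ k)ᴴ * A (k + 1) * κ k := by
    intro k hk hu
    have hp : ((κ k)ᴴ * A (k + 1) * κ k).PosSemidef :=
      (hA (k + 1) hk).posSemidef.conjTranspose_mul_mul_same _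
    have hunit : IsUnit ((κ k)ᴴ * A (k + 1) * κ k) :=
      (((Matrix.isUnit_conjTranspose _).mpr hu).mul (hA (k + 1) hk).isUnit).mul hu
    have hsq := CFC.sqrt_mul_sqrt_self ((κ k)ᴴ * A (k + 1) * κ k) hp.nonneg
    refine ⟨((Matrix.nonneg_iff_posSemidef.mp (CFC.sqrt_nonneg _)).posDef_iff_isUnit).mpr ?_, hsq⟩
    rw [← hsq] at hunit
    exact isUnit_of_mul_eq_zero fun w hw => by
      have : CFC.sqrt ((κ k)ᴴ * A (k + 1) * κ k) * CFC.sqrt ((κ k)ᴴ * A (k + 1) * κ k) * w = 0 := by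
        rw [Matrix.mul_assoc, hw, Matrix.mul_zero]
      exact (hunit.mul_right_eq_zero).mp this
  have hκ : ∀ k < n, IsUnit (κ k) ∧ (κ k)ᴴ * A k * κ k = 1 := by
    intro k
    induction k with
    | zero => exact fun _ => ⟨isUnit_one, by simp [κ, h0]⟩
    | succ k ih =>
      intro hk
      have hu := (ih (by omega)).1
      obtain ⟨h1, h2⟩ := step k hk hu
      have h3 := (Matrix.isUnit_iff_isUnit_det _).mp h1.isUnit
      rw [hsucc]
      refine ⟨hu.mul h1.inv.isUnit, ?_⟩
      rw [Matrix.conjTranspose_mul, h1.inv.isHermitian.eq]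
      calc _ = (CFC.sqrt ((κ k)ᴴ * A (k + 1) * κ k))⁻¹ * ((κ k)ᴴ * A (k + 1) * κ k)
              * (CFC.sqrt ((κ k)ᴴ * A (k + 1) * κ k))⁻¹ := by simp only [Matrix.mul_assoc]
        _ = 1 := by
          conv_lhs => enter [1, 2]; rw [← h2]
          rw [Matrix.nonsing_inv_mul_cancel_left _ _ h3, Matrix.mul_nonsing_inv _ h3]
  refine ⟨κ, rfl, hκ, fun k hk => ?_⟩
  have hu := (hκ k (by omega)).1
  rw [hsucc, Matrix.nonsing_inv_mul_cancel_left _ _ ((Matrix.isUnit_iff_isUnit_det _).mp hu)]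
  exact (step k hk hu).1.inv

/-- `R` is a right orthonormal polynomial of degree `k` and `Q` the reversal of a left orthonormal
one, expressed through the frames `R(U) e` and `Q(U) e`: the first is orthogonal to
`e, …, U^(k-1) e`, the second to `Ue, …, U^k e`. -/
structure IsOrthoPair {N p : ℕ} (U : Matrix (Fin N) (Fin N) ℂ) (e : Matrix (Fin N) (Fin p) ℂ)
    (k : ℕ) (R Q : (Matrix (Fin p) (Fin p) ℂ)[X]) : Prop where
  degree_R : R.degree < ((k + 1 : ℕ) : WithBot ℕ)
  degree_Q : Q.degree < ((k + 1 : ℕ) : WithBot ℕ)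
  norm_R : (applyFrame U e R)ᴴ * applyFrame U e R = 1
  norm_Q : (applyFrame U e Q)ᴴ * applyFrame U e Q = 1
  orth_R : ∀ j < k, (U ^ j * e)ᴴ * applyFrame U e R = 0
  orth_Q : ∀ j < k, (U ^ (j + 1) * e)ᴴ * applyFrame U e Q = 0
  unit_R : IsUnit (R.coeff k)
  unit_Q : IsUnit (Q.coeff 0)

/-! ### One Szegő step: the defects and their norms. -/

section Pair

variable {N p : ℕ} {U : Matrix (Fin N) (Fin N) ℂ} {e : Matrix (Fin N) (Fin p) ℂ} {k : ℕ}
  {R Q : (Matrix (Fin p) (Fin p) ℂ)[X]}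

theorem conjTranspose_mul_eq_zero_comm {f g : Matrix (Fin N) (Fin p) ℂ} (h : fᴴ * g = 0) :
    gᴴ * f = 0 := by
  have := congrArg Matrix.conjTranspose h
  simpa using this

/-- The matrix `α` with `U R(U)e = R'(U)e ρ + Q(U)e α†`. -/
noncomputable def pairCoefficient (U : Matrix (Fin N) (Fin N) ℂ) (e : Matrix (Fin N) (Fin p) ℂ)
    (R Q : (Matrix (Fin p) (Fin p) ℂ)[X]) : Matrix (Fin p) (Fin p) ℂ :=
  (U * applyFrame U e R)ᴴ * applyFrame U e Q

theorem pow_succ_mul_frame (U : Matrix (Fin N) (Fin N) ℂ) (e : Matrix (Fin N) (Fin p) ℂ) (j : ℕ) :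
    U ^ (j + 1) * e = U * (U ^ j * e) := by
  rw [pow_succ', Matrix.mul_assoc]

/-- Both terms are orthogonal to `Ue, …, U^k e`. The choice of `α` adds orthogonality to `Q(U)e`,
and the invertible constant coefficient of `Q` turns this into orthogonality to `e`. -/
theorem IsOrthoPair.orth_defectR (hU : Uᴴ * U = 1) (h : IsOrthoPair U e k R Q) :
    ∀ j < k + 1, (U ^ j * e)ᴴ *
      (applyFrame U e (X * R - Q * C (pairCoefficient U e R Q)ᴴ)) = 0 := by
  rw [applyFrame_sub, applyFrame_X_mul, applyFrame_mul_C]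
  have h1 : ∀ j < k, (U ^ (j + 1) * e)ᴴ *
      (U * applyFrame U e R - applyFrame U e Q * (pairCoefficient U e R Q)ᴴ) = 0 := by
    intro j hj
    rw [Matrix.mul_sub, ← Matrix.mul_assoc, ← Matrix.mul_assoc, h.orth_Q j hj, Matrix.zero_mul,
      sub_zero, pow_succ_mul_frame, Matrix.mul_assoc, conjTranspose_mul_cancel hU, h.orth_R j hj]
  rintro (_ | j) hj
  · have h2 := applyFrame_conjTranspose_mul_of_orthogonal h1 h.degree_Q
    rw [Matrix.mul_sub, ← Matrix.mul_assoc _ (applyFrame U e Q), h.norm_Q, Matrix.one_mul,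
      pairCoefficient, Matrix.conjTranspose_mul, Matrix.conjTranspose_conjTranspose, sub_self] at h2
    have h3 := ((Matrix.isUnit_conjTranspose _).mpr h.unit_Q).mul_right_eq_zero.mp h2.symm
    simpa [pairCoefficient] using h3
  · exact h1 j (by omega)

theorem IsOrthoPair.norm_defectR (hU : Uᴴ * U = 1) (h : IsOrthoPair U e k R Q) :
    (applyFrame U e (X * R - Q * C (pairCoefficient U e R Q)ᴴ))ᴴ *
      (applyFrame U e (X * R - Q * C (pairCoefficient U e R Q)ᴴ))
      = 1 - pairCoefficient U e R Q * (pairCoefficient U e R Q)ᴴ := by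
  rw [applyFrame_sub, applyFrame_X_mul, applyFrame_mul_C]
  set α := pairCoefficient U e R Q with hα
  have h1 : (applyFrame U e Q)ᴴ * (U * applyFrame U e R) = αᴴ := by
    rw [hα, pairCoefficient, Matrix.conjTranspose_mul, Matrix.conjTranspose_conjTranspose]
  have h2 : (applyFrame U e Q)ᴴ * (U * applyFrame U e R - applyFrame U e Q * αᴴ) = 0 := by
    rw [Matrix.mul_sub, ← Matrix.mul_assoc _ (applyFrame U e Q), h.norm_Q, Matrix.one_mul, h1,
      sub_self]
  rw [Matrix.conjTranspose_sub, Matrix.sub_mul, Matrix.conjTranspose_mul _ αᴴ,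
    Matrix.mul_assoc _ _ (_ - _), h2, Matrix.mul_zero, sub_zero, Matrix.mul_sub,
    conjTranspose_mul_cancel hU, h.norm_R, ← Matrix.mul_assoc]
  rfl

/-- The mirror argument, after pulling the defect back by `U†`: the last relation now comes from the
invertible top coefficient of `R`. -/
theorem IsOrthoPair.orth_defectQ (hU : Uᴴ * U = 1) (h : IsOrthoPair U e k R Q) :
    ∀ j < k + 1, (U ^ (j + 1) * e)ᴴ *
      (applyFrame U e (Q - X * R * C (pairCoefficient U e R Q))) = 0 := by
  rw [applyFrame_sub, applyFrame_mul_C, applyFrame_X_mul]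
  set α := pairCoefficient U e R Q with hα
  set D := applyFrame U e Q - U * applyFrame U e R * α with hD
  have hUU : U * Uᴴ = 1 := mul_eq_one_comm.mp hU
  have h1 : ∀ j, (U ^ (j + 1) * e)ᴴ * D = (U ^ j * e)ᴴ * (Uᴴ * D) := by
    intro j
    rw [pow_succ_mul_frame, Matrix.conjTranspose_mul U, Matrix.mul_assoc]
  have h2 : ∀ j < k, (U ^ j * e)ᴴ * (Uᴴ * D) = 0 := by
    intro j hj
    rw [← h1, hD, Matrix.mul_sub, h.orth_Q j hj, ← Matrix.mul_assoc, pow_succ_mul_frame,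
      conjTranspose_mul_cancel hU, h.orth_R j hj, Matrix.zero_mul, sub_zero]
  intro j hj
  rw [h1]
  rcases Nat.lt_succ_iff_lt_or_eq.mp hj with hj | rfl
  · exact h2 j hj
  · have h3 := applyFrame_conjTranspose_mul_of_orthogonal' h2 h.degree_R
    rw [← Matrix.mul_assoc, ← Matrix.conjTranspose_mul, hD, Matrix.mul_sub, ← Matrix.mul_assoc _ _ α,
      conjTranspose_mul_cancel hU, h.norm_R, Matrix.one_mul, hα, pairCoefficient, sub_self] at h3
    exact ((Matrix.isUnit_conjTranspose _).mpr h.unit_R).mul_right_eq_zero.mp h3.symm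

theorem IsOrthoPair.norm_defectQ (hU : Uᴴ * U = 1) (h : IsOrthoPair U e k R Q) :
    (applyFrame U e (Q - X * R * C (pairCoefficient U e R Q)))ᴴ *
      (applyFrame U e (Q - X * R * C (pairCoefficient U e R Q)))
      = 1 - (pairCoefficient U e R Q)ᴴ * pairCoefficient U e R Q := by
  rw [applyFrame_sub, applyFrame_mul_C, applyFrame_X_mul]
  set α := pairCoefficient U e R Q with hα
  have h2 : (U * applyFrame U e R)ᴴ * (applyFrame U e Q - U * applyFrame U e R * α) = 0 := by
    rw [Matrix.mul_sub, ← Matrix.mul_assoc _ _ α, conjTranspose_mul_cancel hU, h.norm_R,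
      Matrix.one_mul, hα, pairCoefficient, sub_self]
  rw [Matrix.conjTranspose_sub, Matrix.sub_mul, Matrix.conjTranspose_mul _ α,
    Matrix.mul_assoc _ _ (_ - _), h2, Matrix.mul_zero, sub_zero, Matrix.mul_sub, h.norm_Q,
    ← Matrix.mul_assoc]
  simp only [hα, pairCoefficient, Matrix.conjTranspose_mul, Matrix.conjTranspose_conjTranspose]

end Pair

theorem sqrt_eq_of_conjTranspose_mul_self {p : ℕ} {A B : Matrix (Fin p) (Fin p) ℂ}
    (hA : A.PosSemidef) (h : Aᴴ * A = B) : CFC.sqrt B = A :=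
  CFC.sqrt_unique (by rw [← h, hA.isHermitian.eq]) hA.nonneg

/-! ### Szegő recursions for consecutive pairs. -/

section Recursion

variable {n p : ℕ} {U : Matrix (Fin (n * p)) (Fin (n * p)) ℂ} {e : Matrix (Fin (n * p)) (Fin p) ℂ}
  {k : ℕ} {R Q R' Q' : (Matrix (Fin p) (Fin p) ℂ)[X]}

/-- Matching top coefficients leave a difference of degree at most `k` whose frame is orthogonal to
`e, …, U^k e`, hence zero. Norms then give `A†A = 1 - αα†`, and positivity identifies `A` with the
square root. -/
theorem IsOrthoPair.recursionR (he : IsCyclicFrame n p U e) (hU : Uᴴ * U = 1) (hk : k + 1 < n)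
    (h : IsOrthoPair U e k R Q) (h' : IsOrthoPair U e (k + 1) R' Q')
    {A : Matrix (Fin p) (Fin p) ℂ} (hA : A.PosSemidef) (hcoeff : R'.coeff (k + 1) * A = R.coeff k) :
    (1 - pairCoefficient U e R Q * (pairCoefficient U e R Q)ᴴ).PosSemidef ∧
    X * R - R' * C (rhoR (pairCoefficient U e R Q)) = Q * C (pairCoefficient U e R Q)ᴴ := by
  set α := pairCoefficient U e R Q with hα
  have hP : X * R - Q * C αᴴ - R' * C A = 0 := by
    have hdeg : (X * R - Q * C αᴴ - R' * C A).degree < ((k + 1 : ℕ) : WithBot ℕ) := by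
      refine degree_lt_of_coeff_eq_zero (degree_sub_lt_of_lt (degree_sub_lt_of_lt
        (degree_X_mul_lt h.degree_R) (degree_lt_mono (degree_mul_C_lt h.degree_Q _) (Nat.le_succ _)))
        (degree_mul_C_lt h'.degree_R _)) ?_
      rw [Polynomial.coeff_sub, Polynomial.coeff_sub, Polynomial.coeff_X_mul, Polynomial.coeff_mul_C,
        Polynomial.coeff_mul_C, hcoeff,
        (Polynomial.degree_lt_iff_coeff_zero Q _).mp h.degree_Q _ le_rfl]
      simp
    refine he.eq_zero_of_applyFrame_eq_zero (degree_lt_mono hdeg hk.le) ?_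
    rw [← Matrix.conjTranspose_mul_self_eq_zero]
    refine applyFrame_orthogonal (fun j hj => ?_) hdeg
    rw [applyFrame_sub, Matrix.mul_sub, h.orth_defectR hU j hj, applyFrame_mul_C, ← Matrix.mul_assoc,
      h'.orth_R j hj, Matrix.zero_mul, sub_zero]
  have hAA : Aᴴ * A = 1 - α * αᴴ := by
    rw [← h.norm_defectR hU, ← hα, sub_eq_zero.mp hP, applyFrame_mul_C, Matrix.conjTranspose_mul,
      Matrix.mul_assoc, ← Matrix.mul_assoc _ _ A, h'.norm_R, Matrix.one_mul]
  refine ⟨hAA ▸ Matrix.posSemidef_conjTranspose_mul_self A, ?_⟩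
  rw [rhoR, sqrt_eq_of_conjTranspose_mul_self hA hAA, ← sub_eq_zero, ← hP]
  abel

/-- As for `R`, but now it is the constant coefficient of the difference that cancels, and its frame
is orthogonal to `Ue, …, U^(k+1)e`. -/
theorem IsOrthoPair.recursionQ (he : IsCyclicFrame n p U e) (hU : Uᴴ * U = 1) (hk : k + 1 < n)
    (h : IsOrthoPair U e k R Q) (h' : IsOrthoPair U e (k + 1) R' Q')
    {A : Matrix (Fin p) (Fin p) ℂ} (hA : A.PosSemidef) (hcoeff : Q'.coeff 0 * A = Q.coeff 0) :
    Q - Q' * C (rhoL (pairCoefficient U e R Q)) = X * R * C (pairCoefficient U e R Q) := by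
  set α := pairCoefficient U e R Q with hα
  have hP : Q - X * R * C α - Q' * C A = 0 := by
    have hdeg : (Q - X * R * C α - Q' * C A).degree < ((k + 1 + 1 : ℕ) : WithBot ℕ) :=
      degree_sub_lt_of_lt (degree_sub_lt_of_lt (degree_lt_mono h.degree_Q (Nat.le_succ _))
        (degree_mul_C_lt (degree_X_mul_lt h.degree_R) _)) (degree_mul_C_lt h'.degree_Q _)
    refine he.eq_zero_of_applyFrame_eq_zero (degree_lt_mono hdeg hk) ?_
    rw [← Matrix.conjTranspose_mul_self_eq_zero,
      applyFrame_conjTranspose_mul_of_orthogonal (fun j hj => ?_) hdeg]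
    · rw [Polynomial.coeff_sub, Polynomial.coeff_sub, Polynomial.coeff_mul_C,
        Polynomial.coeff_mul_C, Polynomial.coeff_X_mul_zero, hcoeff]
      simp
    · rw [applyFrame_sub, Matrix.mul_sub, h.orth_defectQ hU j hj, applyFrame_mul_C,
        ← Matrix.mul_assoc, h'.orth_Q j hj, Matrix.zero_mul, sub_zero]
  have hAA : Aᴴ * A = 1 - αᴴ * α := by
    rw [← h.norm_defectQ hU, ← hα, sub_eq_zero.mp hP, applyFrame_mul_C, Matrix.conjTranspose_mul,
      Matrix.mul_assoc, ← Matrix.mul_assoc _ _ A, h'.norm_Q, Matrix.one_mul]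
  rw [rhoL, sqrt_eq_of_conjTranspose_mul_self hA hAA, ← sub_eq_zero, ← hP]
  abel

/-- At the last index the defect is orthogonal to the whole space. As `α` is square, `αα† = 1` gives
`α†α = 1`, which kills the other defect. -/
theorem IsOrthoPair.last (he : IsCyclicFrame n p U e) (hU : Uᴴ * U = 1) (hk : k + 1 = n)
    (h : IsOrthoPair U e k R Q) :
    pairCoefficient U e R Q * (pairCoefficient U e R Q)ᴴ = 1 ∧
    applyFrame U e (X * R - Q * C (pairCoefficient U e R Q)ᴴ) = 0 ∧
    applyFrame U e (Q - X * R * C (pairCoefficient U e R Q)) = 0 := by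
  have h0 := he.eq_zero_of_orthogonal (hk ▸ h.orth_defectR hU)
  have h1 : pairCoefficient U e R Q * (pairCoefficient U e R Q)ᴴ = 1 := by
    have := h.norm_defectR hU
    rw [h0, Matrix.mul_zero] at this
    exact (sub_eq_zero.mp this.symm).symm
  refine ⟨h1, h0, ?_⟩
  rw [← Matrix.conjTranspose_mul_self_eq_zero, h.norm_defectQ hU, mul_eq_one_comm.mp h1, sub_self]

end Recursion

/-! ### Existence of the orthogonal polynomials and Verblunsky coefficients. -/

section Orthonormal

variable {n p : ℕ} {U : Matrix (Fin (n * p)) (Fin (n * p)) ℂ} {e : Matrix (Fin (n * p)) (Fin p) ℂ}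
  {ΦR ΦL : ℕ → (Matrix (Fin p) (Fin p) ℂ)[X]} {κR κL : ℕ → Matrix (Fin p) (Fin p) ℂ}

theorem degree_lt_succ_of_monic {k : ℕ} {Φ : (Matrix (Fin p) (Fin p) ℂ)[X]}
    (h : (Φ - X ^ k).degree < (k : WithBot ℕ)) : Φ.degree < ((k + 1 : ℕ) : WithBot ℕ) := by
  rw [Polynomial.degree_lt_iff_coeff_zero] at *
  intro m hm
  have := h m (by omega)
  rwa [Polynomial.coeff_sub, Polynomial.coeff_X_pow, if_neg (by omega), sub_zero] at this

theorem coeff_eq_one_of_monic {k : ℕ} {Φ : (Matrix (Fin p) (Fin p) ℂ)[X]}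
    (h : (Φ - X ^ k).degree < (k : WithBot ℕ)) : Φ.coeff k = 1 := by
  have := (Polynomial.degree_lt_iff_coeff_zero _ _).mp h k le_rfl
  rwa [Polynomial.coeff_sub, Polynomial.coeff_X_pow, if_pos rfl, sub_eq_zero] at this

theorem isOrthoPair_of_isMOPUC (hU : Uᴴ * U = 1) (hR : IsRightMOPUC (spectralMeasure U e) n ΦR κR)
    (hL : IsLeftMOPUC (spectralMeasure U e) n ΦL κL) {k : ℕ} (hk : k < n) :
    IsOrthoPair U e k (ΦR k * C (κR k)) (reversed k (C (κL k) * ΦL k)) := by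
  have dR := degree_lt_succ_of_monic (hR.monic k hk)
  have dL := degree_lt_succ_of_monic (hL.monic k hk)
  have nR := hR.orthonormal k hk k hk
  have nL := hL.orthonormal k hk k hk
  rw [if_pos rfl, innerR_spectralMeasure e hU] at nR
  rw [if_pos rfl, innerL_spectralMeasure e hU (degree_C_mul_lt dL _) (degree_C_mul_lt dL _)] at nL
  refine ⟨degree_mul_C_lt dR _, degree_reversed_lt _ _, nR, nL, ?_, ?_, ?_, ?_⟩
  · intro j hj
    have := hR.orthogonal k hk j hj
    rw [innerR_spectralMeasure e hU, applyFrame_X_pow] at this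
    rw [applyFrame_mul_C, ← Matrix.mul_assoc, this, Matrix.zero_mul]
  · intro j hj
    -- Reversal in degree `k` sends `z^(k-(j+1))` to `z^(j+1)`.
    have := hL.orthogonal k hk (k - (j + 1)) (by omega)
    have dX : (X ^ (k - (j + 1)) : (Matrix (Fin p) (Fin p) ℂ)[X]).degree
        < ((k + 1 : ℕ) : WithBot ℕ) :=
      (Polynomial.degree_X_pow_le _).trans_lt (by exact_mod_cast (by omega))
    rw [innerL_spectralMeasure e hU dX dL, reversed_X_pow (by omega), applyFrame_X_pow,
      show k - (k - (j + 1)) = j + 1 by omega] at this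
    rw [reversed_C_mul, applyFrame_mul_C, ← Matrix.mul_assoc, conjTranspose_mul_eq_zero_comm this,
      Matrix.zero_mul]
  · rw [Polynomial.coeff_mul_C, coeff_eq_one_of_monic (hR.monic k hk), one_mul]
    rw [applyFrame_mul_C, ← Matrix.mul_assoc] at nR
    exact isUnit_of_left_inv nR
  · rw [coeff_reversed, if_pos (Nat.zero_le _), Nat.sub_zero, Polynomial.coeff_C_mul,
      coeff_eq_one_of_monic (hL.monic k hk), mul_one]
    rw [reversed_C_mul, applyFrame_mul_C, ← Matrix.mul_assoc] at nL
    exact isUnit_of_left_inv nL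

theorem exists_isRightMOPUC (he : IsCyclicFrame n p U e) (hU : Uᴴ * U = 1) :
    ∃ Φ κ, IsRightMOPUC (spectralMeasure U e) n Φ κ := by
  have hF : ∀ k : ℕ, ∃ F : (Matrix (Fin p) (Fin p) ℂ)[X], F.degree < (k : WithBot ℕ) ∧
      (k < n → ∀ j < k, (U ^ j * e)ᴴ * applyFrame U e (X ^ k + F) = 0) := by
    intro k
    by_cases hk : k < n
    · obtain ⟨F, h1, h2⟩ := he.exists_add_orthogonal hk.le (U ^ k * e)
      exact ⟨F, h1, fun _ => by rwa [applyFrame_add, applyFrame_X_pow]⟩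
    · exact ⟨0, by rw [Polynomial.degree_zero]; exact WithBot.bot_lt_coe k, fun h => absurd h hk⟩
  choose F hF1 hF2 using hF
  have hmon : ∀ k : ℕ, (X ^ k + F k - X ^ k).degree < (k : WithBot ℕ) := by
    intro k; rw [add_sub_cancel_left]; exact hF1 k
  have hnorm0 : (applyFrame U e (X ^ 0 + F 0))ᴴ * applyFrame U e (X ^ 0 + F 0) = 1 := by
    have : F 0 = 0 := Polynomial.ext fun m =>
      (Polynomial.degree_lt_iff_coeff_zero _ _).mp (hF1 0) m m.zero_le
    rw [this, add_zero, applyFrame_X_pow, pow_zero, Matrix.one_mul]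
    exact he.orthonormal
  have hpos : ∀ k < n, ((applyFrame U e (X ^ k + F k))ᴴ * applyFrame U e (X ^ k + F k)).PosDef := by
    intro k hk
    rw [(Matrix.posSemidef_conjTranspose_mul_self _).posDef_iff_isUnit]
    refine isUnit_of_mul_eq_zero fun w hw => ?_
    have h1 : applyFrame U e ((X ^ k + F k) * C w) = 0 := by
      rw [← Matrix.conjTranspose_mul_self_eq_zero, applyFrame_mul_C, Matrix.conjTranspose_mul,
        Matrix.mul_assoc, ← Matrix.mul_assoc _ _ w, hw, Matrix.mul_zero]
    have h2 := congrArg (fun P => P.coeff k) (he.eq_zero_of_applyFrame_eq_zero (degree_lt_mono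
      (degree_mul_C_lt (degree_lt_succ_of_monic (hmon k)) _) hk) h1)
    simpa only [Polynomial.coeff_mul_C, coeff_eq_one_of_monic (hmon k), one_mul,
      Polynomial.coeff_zero] using h2
  obtain ⟨κ, h0, h1, h2⟩ := exists_normalization n
    (fun k => (applyFrame U e (X ^ k + F k))ᴴ * applyFrame U e (X ^ k + F k)) hnorm0 hpos
  refine ⟨fun k => X ^ k + F k, κ, fun k _ => hmon k, ?_, ?_, h0, h2⟩
  · intro k hk j hj
    rw [innerR_spectralMeasure e hU, applyFrame_X_pow, hF2 k hk j hj]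
  · have hlt : ∀ i j, i < j → j < n → (applyFrame U e ((X ^ i + F i) * C (κ i)))ᴴ *
        applyFrame U e ((X ^ j + F j) * C (κ j)) = 0 := by
      intro i j hij hj
      refine applyFrame_orthogonal (k := j) (fun l hl => ?_) (degree_lt_mono
        (degree_mul_C_lt (degree_lt_succ_of_monic (hmon i)) _) hij)
      rw [applyFrame_mul_C, ← Matrix.mul_assoc, hF2 j hj l hl, Matrix.zero_mul]
    intro i hi j hj
    rw [innerR_spectralMeasure e hU]
    rcases lt_trichotomy i j with h | rfl | h
    · rw [if_neg h.ne, hlt i j h hj]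
    · rw [if_pos rfl, applyFrame_mul_C, Matrix.conjTranspose_mul, ← (h1 i hi).2]
      simp only [Matrix.mul_assoc]
    · rw [if_neg h.ne', conjTranspose_mul_eq_zero_comm (hlt j i h hi)]

/-- The reversed polynomials `Q_k = 1 + zF` are built first, with `F(U)e` making `U†e + F(U)e`
orthogonal to `e, …, U^(k-1)e`; applying `U` makes `Q_k(U)e` orthogonal to `Ue, …, U^k e`. -/
theorem exists_isLeftMOPUC (he : IsCyclicFrame n p U e) (hU : Uᴴ * U = 1) :
    ∃ Φ κ, IsLeftMOPUC (spectralMeasure U e) n Φ κ := by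
  have hF : ∀ k : ℕ, ∃ F : (Matrix (Fin p) (Fin p) ℂ)[X], F.degree < (k : WithBot ℕ) ∧
      (k < n → ∀ j < k, (U ^ (j + 1) * e)ᴴ * applyFrame U e (X ^ 0 + X * F) = 0) := by
    intro k
    by_cases hk : k < n
    · obtain ⟨F, h1, h2⟩ := he.exists_add_orthogonal hk.le (Uᴴ * e)
      refine ⟨F, h1, fun _ j hj => ?_⟩
      rw [← h2 j hj, applyFrame_add, applyFrame_X_pow, pow_zero, Matrix.one_mul, applyFrame_X_mul,
        pow_succ_mul_frame, Matrix.conjTranspose_mul U, Matrix.mul_assoc, Matrix.mul_add Uᴴ,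
        ← Matrix.mul_assoc Uᴴ U, hU, Matrix.one_mul]
    · exact ⟨0, by rw [Polynomial.degree_zero]; exact WithBot.bot_lt_coe k, fun h => absurd h hk⟩
  choose F hF1 hF2 using hF
  set Q : ℕ → (Matrix (Fin p) (Fin p) ℂ)[X] := fun k => X ^ 0 + X * F k with hQ
  have hQ0 : ∀ k, (Q k).coeff 0 = 1 := by
    intro k; simp [hQ]
  have hQd : ∀ k, (Q k).degree < ((k + 1 : ℕ) : WithBot ℕ) := by
    intro k
    rw [Polynomial.degree_lt_iff_coeff_zero]
    rintro (_ | m) hm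
    · omega
    · have := (Polynomial.degree_lt_iff_coeff_zero _ _).mp (hF1 k) m (by omega)
      simp [hQ, Polynomial.coeff_one, this]
  have hmon : ∀ k : ℕ, (reversed k (Q k) - X ^ k).degree < (k : WithBot ℕ) := by
    intro k
    refine degree_lt_of_coeff_eq_zero (degree_sub_lt_of_lt (degree_reversed_lt _ _)
      ((Polynomial.degree_X_pow_le k).trans_lt (by exact_mod_cast Nat.lt_succ_self k))) ?_
    rw [Polynomial.coeff_sub, coeff_reversed, if_pos le_rfl, Nat.sub_self, hQ0]
    simp
  have hnorm0 : (applyFrame U e (Q 0))ᴴ * applyFrame U e (Q 0) = 1 := by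
    have : F 0 = 0 := Polynomial.ext fun m =>
      (Polynomial.degree_lt_iff_coeff_zero _ _).mp (hF1 0) m m.zero_le
    simp only [hQ]
    rw [this, mul_zero, add_zero, applyFrame_X_pow, pow_zero, Matrix.one_mul]
    exact he.orthonormal
  have hpos : ∀ k < n, ((applyFrame U e (Q k))ᴴ * applyFrame U e (Q k)).PosDef := by
    intro k hk
    rw [(Matrix.posSemidef_conjTranspose_mul_self _).posDef_iff_isUnit]
    refine isUnit_of_mul_eq_zero fun w hw => ?_
    have h1 : applyFrame U e (Q k * C w) = 0 := by
      rw [← Matrix.conjTranspose_mul_self_eq_zero, applyFrame_mul_C, Matrix.conjTranspose_mul,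
        Matrix.mul_assoc, ← Matrix.mul_assoc _ _ w, hw, Matrix.mul_zero]
    have h2 := congrArg (fun P => P.coeff 0) (he.eq_zero_of_applyFrame_eq_zero (degree_lt_mono
      (degree_mul_C_lt (hQd k) _) hk) h1)
    simpa only [Polynomial.coeff_mul_C, hQ0, one_mul, Polynomial.coeff_zero] using h2
  obtain ⟨κ, h0, h1, h2⟩ := exists_normalization n
    (fun k => (applyFrame U e (Q k))ᴴ * applyFrame U e (Q k)) hnorm0 hpos
  refine ⟨fun k => reversed k (Q k), fun k => (κ k)ᴴ, fun k _ => hmon k, ?_, ?_, by simp [h0], ?_⟩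
  · intro k hk j hj
    rw [innerL_spectralMeasure e hU ((Polynomial.degree_X_pow_le j).trans_lt
      (by exact_mod_cast (by omega))) (degree_reversed_lt k _), reversed_X_pow hj.le,
      reversed_reversed (hQd k), applyFrame_X_pow]
    apply conjTranspose_mul_eq_zero_comm
    have := hF2 k hk (k - j - 1) (by omega)
    rwa [show k - j - 1 + 1 = k - j by omega] at this
  -- Both polynomials are reversed in the larger degree `j`; the one of degree `i < j` then has zero
  -- constant coefficient, the only one that could contribute.
  · have hlt : ∀ i j, i < j → j < n →
        (applyFrame U e (reversed j (C (κ i)ᴴ * reversed i (Q i))))ᴴ *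
        applyFrame U e (reversed j (C (κ j)ᴴ * reversed j (Q j))) = 0 := by
      intro i j hij hj
      rw [applyFrame_conjTranspose_mul_of_orthogonal (k := j) (fun l hl => ?_)
        (degree_reversed_lt _ _), coeff_reversed, if_pos (Nat.zero_le _), Nat.sub_zero,
        Polynomial.coeff_C_mul, coeff_reversed, if_neg (by omega)]
      · simp
      · rw [reversed_C_mul, reversed_reversed (hQd j), applyFrame_mul_C, ← Matrix.mul_assoc,
          hF2 j hj l hl, Matrix.zero_mul]
    have hd : ∀ i j, i ≤ j →
        (C (κ i)ᴴ * reversed i (Q i)).degree < ((j + 1 : ℕ) : WithBot ℕ) := fun i j hij =>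
      degree_C_mul_lt (degree_lt_mono (degree_reversed_lt i _) (by omega)) _
    intro i hi j hj
    rcases lt_trichotomy i j with h | rfl | h
    · rw [innerL_spectralMeasure e hU (hd i j h.le) (hd j j le_rfl), if_neg h.ne,
        conjTranspose_mul_eq_zero_comm (hlt i j h hj)]
    · rw [innerL_spectralMeasure e hU (hd i i le_rfl) (hd i i le_rfl), if_pos rfl,
        reversed_C_mul, reversed_reversed (hQd i), Matrix.conjTranspose_conjTranspose,
        applyFrame_mul_C, Matrix.conjTranspose_mul, ← (h1 i hi).2]
      simp only [Matrix.mul_assoc]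
    · rw [innerL_spectralMeasure e hU (hd i i le_rfl) (hd j i h.le), if_neg h.ne',
        hlt j i h hi]
  · intro k hk
    rw [← Matrix.conjTranspose_nonsing_inv, ← Matrix.conjTranspose_mul,
      (h2 k hk).isHermitian.eq]
    exact h2 k hk

theorem exists_isVerblunsky (he : IsCyclicFrame n p U e) (hU : Uᴴ * U = 1)
    (hR : IsRightMOPUC (spectralMeasure U e) n ΦR κR)
    (hL : IsLeftMOPUC (spectralMeasure U e) n ΦL κL) :
    ∃ α, IsVerblunsky (spectralMeasure U e) n (fun k => ΦR k * C (κR k))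
      (fun k => C (κL k) * ΦL k) α := by
  have hpair : ∀ k, k < n → _ := fun k hk => isOrthoPair_of_isMOPUC hU hR hL hk
  have dL : ∀ k < n, (C (κL k) * ΦL k).degree < ((k + 1 : ℕ) : WithBot ℕ) :=
    fun k hk => degree_C_mul_lt (degree_lt_succ_of_monic (hL.monic k hk)) _
  have uR : ∀ k < n, IsUnit (κR k) := fun k hk => by
    have := (hpair k hk).unit_R
    rwa [Polynomial.coeff_mul_C, coeff_eq_one_of_monic (hR.monic k hk), one_mul] at this
  have cQ : ∀ k < n, (reversed k (C (κL k) * ΦL k)).coeff 0 = (κL k)ᴴ := fun k hk => by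
    rw [coeff_reversed, if_pos (Nat.zero_le _), Nat.sub_zero, Polynomial.coeff_C_mul,
      coeff_eq_one_of_monic (hL.monic k hk), mul_one]
  have uL : ∀ k < n, IsUnit (κL k) := fun k hk => by
    have := (hpair k hk).unit_Q
    rwa [cQ k hk, Matrix.isUnit_conjTranspose] at this
  have recR : ∀ k, k + 1 < n → _ := fun k hk =>
    (hpair k (by omega)).recursionR he hU hk (hpair (k + 1) hk)
      (hR.kappa_pos k hk).inv.posSemidef (by
        have u := (Matrix.isUnit_iff_isUnit_det _).mp (uR k (by omega))
        have u' := (Matrix.isUnit_iff_isUnit_det _).mp (uR (k + 1) hk)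
        rw [Polynomial.coeff_mul_C, Polynomial.coeff_mul_C, coeff_eq_one_of_monic (hR.monic _ hk),
          coeff_eq_one_of_monic (hR.monic k (by omega)), one_mul, one_mul, Matrix.mul_inv_rev,
          Matrix.nonsing_inv_nonsing_inv _ u, Matrix.mul_nonsing_inv_cancel_left _ _ u'])
  have recQ : ∀ k, k + 1 < n → _ := fun k hk =>
    (hpair k (by omega)).recursionQ he hU hk (hpair (k + 1) hk)
      (hL.kappa_pos k hk).inv.posSemidef (by
        have u := (Matrix.isUnit_iff_isUnit_det _).mp (uL k (by omega))
        have u' := (Matrix.isUnit_iff_isUnit_det _).mp (uL (k + 1) hk)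
        rw [cQ _ hk, cQ _ (by omega), ← (hL.kappa_pos k hk).inv.isHermitian.eq,
          ← Matrix.conjTranspose_mul, Matrix.mul_inv_rev, Matrix.nonsing_inv_nonsing_inv _ u,
          Matrix.nonsing_inv_mul_cancel_right _ _ u'])
  refine ⟨fun k => pairCoefficient U e (ΦR k * C (κR k)) (reversed k (C (κL k) * ΦL k)),
    ?_, ?_, ?_, ?_, ?_, ?_⟩
  · intro k hk
    rcases (Nat.succ_le_of_lt hk).lt_or_eq with hk' | hk'
    · exact (recR k hk').1
    · rw [((hpair k hk).last he hU hk').1, sub_self]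
      exact Matrix.PosSemidef.zero
  · intro k hk
    -- Reversal in degree `k + 1` turns the recursion for the reversed left polynomials into the
    -- left Szegő recursion.
    have h1 := congrArg (reversed (k + 1)) (recQ k hk)
    rw [reversed_sub, reversed_mul_C, reversed_mul_C, reversed_succ_X_mul,
      reversed_reversed (dL (k + 1) hk), reversed_succ_reversed _ (dL k (by omega))] at h1
    rwa [show (rhoL (pairCoefficient U e (ΦR k * C (κR k)) (reversed k (C (κL k) * ΦL k))))ᴴ = _
      from (Matrix.nonneg_iff_posSemidef.mp (CFC.sqrt_nonneg _)).isHermitian.eq] at h1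
  · intro k hk
    exact (recR k hk).2
  · intro k hk
    exact ((hpair k (by omega)).last he hU hk).1
  · intro k hk
    have hk' : k < n := by omega
    have hd := degree_sub_lt_of_lt (degree_X_mul_lt (dL k hk')) (degree_C_mul_lt (degree_lt_mono
      (degree_reversed_lt k (ΦR k * C (κR k))) (Nat.le_succ _)) (pairCoefficient U e
        (ΦR k * C (κR k)) (reversed k (C (κL k) * ΦL k)))ᴴ)
    rw [innerL_spectralMeasure e hU hd hd, reversed_sub, reversed_succ_X_mul,
      reversed_C_mul (k + 1) (reversed k _), reversed_succ_reversed _ (hpair k hk').degree_R,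
      Matrix.conjTranspose_conjTranspose,
      ((hpair k hk').last he hU hk).2.2, Matrix.mul_zero]
  · intro k hk
    have hk' : k < n := by omega
    rw [innerR_spectralMeasure e hU, ((hpair k hk').last he hU hk).2.1, Matrix.mul_zero]

theorem nonempty_szegoSystem (he : IsCyclicFrame n p U e) (hU : Uᴴ * U = 1) :
    Nonempty (SzegoSystem (spectralMeasure U e) n) := by
  obtain ⟨ΦR, κR, hR⟩ := exists_isRightMOPUC he hU
  obtain ⟨ΦL, κL, hL⟩ := exists_isLeftMOPUC he hU
  obtain ⟨α, hα⟩ := exists_isVerblunsky he hU hR hL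
  exact ⟨⟨ΦR, κR, ΦL, κL, α, hR, hL, hα⟩⟩

end Orthonormal

/-! ### Values of orthonormal polynomials at `1`. -/

section PairAtOne

variable {n p : ℕ} {U : Matrix (Fin (n * p)) (Fin (n * p)) ℂ} {e : Matrix (Fin (n * p)) (Fin p) ℂ}
  {k : ℕ} {R Q : (Matrix (Fin p) (Fin p) ℂ)[X]}

/-- If `R(1)w = 0`, then `Rw = (z - 1)q` with `deg q < k`. As `R(U)e` is orthogonal to `q(U)e`, the
fixed-vector argument gives `q = 0`, so `Rw = 0` and `w = 0`. -/
theorem IsOrthoPair.isUnit_eval_R (he : IsCyclicFrame n p U e) (hU : Uᴴ * U = 1) (hk : k < n)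
    (h : IsOrthoPair U e k R Q) : IsUnit (R.eval 1) := by
  refine isUnit_of_mul_eq_zero fun w hw => ?_
  obtain ⟨q, hq, hRq⟩ := exists_eq_X_mul_sub_of_eval_one_eq_zero (degree_mul_C_lt h.degree_R w)
    ((eval_one_mul_C R w).trans hw)
  have h0 : q = 0 := by
    refine he.eq_zero_of_inner_eq hU hk hq ?_
    rw [← applyFrame_X_mul, ← applyFrame_sub, ← hRq, applyFrame_mul_C, ← Matrix.mul_assoc,
      applyFrame_orthogonal h.orth_R hq, Matrix.zero_mul]
  have h1 := congrArg (applyFrame U e) hRq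
  rw [h0, mul_zero, sub_zero, applyFrame_zero, applyFrame_mul_C] at h1
  rw [← Matrix.one_mul w, ← h.norm_R, Matrix.mul_assoc, h1, Matrix.mul_zero]

theorem IsOrthoPair.orth_Q_mul (h : IsOrthoPair U e k R Q) {q : (Matrix (Fin p) (Fin p) ℂ)[X]}
    (hq : q.degree < (k : WithBot ℕ)) : (U * applyFrame U e q)ᴴ * applyFrame U e Q = 0 := by
  rw [← applyFrame_X_mul, applyFrame_conjTranspose_mul_of_orthogonal h.orth_Q (degree_X_mul_lt hq),
    Polynomial.coeff_X_mul_zero, Matrix.conjTranspose_zero, Matrix.zero_mul]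

theorem IsOrthoPair.exists_interpolation (he : IsCyclicFrame n p U e) (hU : Uᴴ * U = 1)
    (hk : k < n) (h : IsOrthoPair U e k R Q) :
    ∃ q : (Matrix (Fin p) (Fin p) ℂ)[X], q.degree < (k : WithBot ℕ) ∧
      applyFrame U e R * ((R.eval 1)⁻¹ * Q.eval 1)
        = applyFrame U e Q + (U * applyFrame U e q - applyFrame U e q) := by
  have hu := (Matrix.isUnit_iff_isUnit_det _).mp (h.isUnit_eval_R he hU hk)
  obtain ⟨q, hq, hRq⟩ := exists_eq_X_mul_sub_of_eval_one_eq_zero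
    (F := R * C ((R.eval 1)⁻¹ * Q.eval 1) - Q)
    (degree_sub_lt_of_lt (degree_mul_C_lt h.degree_R _) h.degree_Q) (by
      rw [Polynomial.eval_sub, eval_one_mul_C, Matrix.mul_nonsing_inv_cancel_left _ _ hu, sub_self])
  refine ⟨q, hq, ?_⟩
  have h1 := congrArg (applyFrame U e) hRq
  rw [applyFrame_sub, applyFrame_sub, applyFrame_X_mul, applyFrame_mul_C] at h1
  rw [← h1, add_sub_cancel]

/-- A Christoffel–Darboux identity on the diagonal: `R(1)⁻¹ Q(1)` is unitary. -/
theorem IsOrthoPair.unitary_eval (he : IsCyclicFrame n p U e) (hU : Uᴴ * U = 1)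
    (hk : k < n) (h : IsOrthoPair U e k R Q) :
    ((R.eval 1)⁻¹ * Q.eval 1)ᴴ * ((R.eval 1)⁻¹ * Q.eval 1) = 1 := by
  obtain ⟨q, hq, hRq⟩ := h.exists_interpolation he hU hk
  set W := (R.eval 1)⁻¹ * Q.eval 1
  set x := applyFrame U e q with hx
  -- Both sides are orthogonal sums, and `x`, `Ux` have the same Gram matrix, so `W†W` equals the
  -- Gram matrix of `Q(U)e`, which is `1`.
  have h1 : applyFrame U e R * W + x = applyFrame U e Q + U * x := by rw [hRq]; abel
  have h2 := congrArg (fun f => fᴴ * f) h1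
  have o1 : xᴴ * applyFrame U e R = 0 := applyFrame_orthogonal h.orth_R hq
  have o2 : (U * x)ᴴ * applyFrame U e Q = 0 := h.orth_Q_mul hq
  simp only [Matrix.conjTranspose_add, Matrix.add_mul, Matrix.mul_add] at h2
  rw [conjTranspose_mul_cancel hU, o2, conjTranspose_mul_eq_zero_comm o2,
    ← Matrix.mul_assoc xᴴ, o1, Matrix.zero_mul, Matrix.conjTranspose_mul _ W, Matrix.mul_assoc Wᴴ,
    Matrix.mul_assoc Wᴴ, conjTranspose_mul_eq_zero_comm o1, ← Matrix.mul_assoc _ _ W, h.norm_R,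
    h.norm_Q] at h2
  simpa using h2

end PairAtOne

/-! ### Neretin's operation and the reflections. -/

section Neretin

variable {n p : ℕ}

/-- The rows of a matrix with index satisfying `P`. -/
def blockRows {q : Type*} (P : Fin n × Fin p → Prop) (Y : Matrix (Fin n × Fin p) q ℂ) :
    Matrix {x // P x} q ℂ :=
  Y.submatrix Subtype.val id

theorem blockRows_apply {q : Type*} {P : Fin n × Fin p → Prop} (Y : Matrix (Fin n × Fin p) q ℂ)
    (x : {x // P x}) (j : q) : blockRows P Y x j = Y x j := rfl

theorem toBlock_mul_blockRows {q : Type*} (r : ℕ) (P : Fin n × Fin p → Prop)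
    (M : Matrix (Fin n × Fin p) (Fin n × Fin p) ℂ) (Y : Matrix (Fin n × Fin p) q ℂ) :
    M.toBlock P (InFirst r) * blockRows (InFirst r) Y
      + M.toBlock P (fun x => ¬ InFirst r x) * blockRows (fun x => ¬ InFirst r x) Y
      = blockRows P (M * Y) := by
  ext i j
  rw [Matrix.add_apply, Matrix.mul_apply, Matrix.mul_apply, blockRows_apply, Matrix.mul_apply]
  exact Fintype.sum_subtype_add_sum_subtype (InFirst r) fun x => M i x * Y x j

/-- `Ξ` closes a feedback loop on the first `r` blocks: if `u`, `v` are the upper and lower parts of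
`Y`, then `Au + Bv = u` gives `u = (1 - A)⁻¹Bv`, and `Cu + Dv` becomes `Ξv`. -/
theorem neretin_mul {q : Type*} (r : ℕ) {M : Matrix (Fin n × Fin p) (Fin n × Fin p) ℂ}
    {Y : Matrix (Fin n × Fin p) q ℂ}
    (hM : IsUnit (1 - M.toBlock (InFirst r) (InFirst r)))
    (hY : blockRows (InFirst r) (M * Y) = blockRows (InFirst r) Y) :
    neretin r M * blockRows (fun x => ¬ InFirst r x) Y
      = blockRows (fun x => ¬ InFirst r x) (M * Y) := by
  rw [← toBlock_mul_blockRows r] at hY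
  rw [← toBlock_mul_blockRows r, neretin, Matrix.add_mul, add_comm]
  congr 1
  have h1 : M.toBlock (InFirst r) (fun x => ¬ InFirst r x) * blockRows (fun x => ¬ InFirst r x) Y
      = (1 - M.toBlock (InFirst r) (InFirst r)) * blockRows (InFirst r) Y := by
    rw [Matrix.sub_mul, Matrix.one_mul]
    exact eq_sub_of_add_eq' hY
  rw [Matrix.mul_assoc, h1, Matrix.mul_assoc,
    Matrix.nonsing_inv_mul_cancel_left _ _ ((Matrix.isUnit_iff_isUnit_det _).mp hM)]

theorem piHat_apply_of_inFirst {r : ℕ} (M : Matrix (Fin n × Fin p) (Fin n × Fin p) ℂ)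
    {x : Fin n × Fin p} (hx : InFirst r x) (y : Fin n × Fin p) :
    piHat r M x y = if x = y then 1 else 0 := by
  rw [piHat, Matrix.reindex_apply, Matrix.submatrix_apply,
    Equiv.sumCompl_symm_apply_of_pos hx]
  by_cases hy : InFirst r y
  · rw [Equiv.sumCompl_symm_apply_of_pos hy, Matrix.fromBlocks_apply₁₁, Matrix.one_apply]
    simp only [Subtype.mk.injEq]
  · rw [Equiv.sumCompl_symm_apply_of_neg hy, Matrix.fromBlocks_apply₁₂, Matrix.zero_apply,
      if_neg]
    rintro rfl
    exact hy hx

theorem piHat_apply_of_not_inFirst {r : ℕ} (M : Matrix (Fin n × Fin p) (Fin n × Fin p) ℂ)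
    {x y : Fin n × Fin p} (hx : ¬ InFirst r x) (hy : ¬ InFirst r y) :
    piHat r M x y = neretin r M ⟨x, hx⟩ ⟨y, hy⟩ := by
  rw [piHat, Matrix.reindex_apply, Matrix.submatrix_apply,
    Equiv.sumCompl_symm_apply_of_neg hx, Equiv.sumCompl_symm_apply_of_neg hy,
    Matrix.fromBlocks_apply₂₂]

/-- Block `k` is already an identity block of the second factor, so that factor does not affect this
diagonal block of the product. -/
theorem reflection_apply (k : Fin n) (M : Matrix (Fin n × Fin p) (Fin n × Fin p) ℂ) (i j : Fin p) :
    reflection (k : ℕ) M (k, i) (k, j) = neretinBlock k M i j := by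
  rw [reflection, Matrix.mul_apply, Finset.sum_eq_single (k, j)]
  · rw [Matrix.conjTranspose_apply, piHat_apply_of_inFirst M
      (show InFirst ((k : ℕ) + 1) (k, j) from Nat.lt_succ_self (k : ℕ)),
      if_pos rfl, star_one, mul_one,
      piHat_apply_of_not_inFirst M (lt_irrefl (k : ℕ)) (lt_irrefl (k : ℕ))]
    rfl
  · intro y _ hy
    rw [Matrix.conjTranspose_apply, piHat_apply_of_inFirst M
      (show InFirst ((k : ℕ) + 1) (k, j) from Nat.lt_succ_self (k : ℕ)),
      if_neg (Ne.symm hy), star_zero, mul_zero]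
  · exact fun h => absurd (Finset.mem_univ _) h

theorem pseudoInner_operatorOfMatrix {ε : Fin n → Matrix (Fin (n * p)) (Fin p) ℂ}
    (hε : (frameMatrix ε)ᴴ * frameMatrix ε = 1) (M : Matrix (Fin n × Fin p) (Fin n × Fin p) ℂ)
    (k : Fin n) (i j : Fin p) :
    pseudoInner (ε k) (operatorOfMatrix ε M * ε k) i j = M (k, i) (k, j) := by
  have h : ε k = (frameMatrix ε).submatrix id (fun i => (k, i)) := rfl
  have h1 : (frameMatrix ε)ᴴ * (operatorOfMatrix ε M * frameMatrix ε) = M := by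
    rw [operatorOfMatrix, Matrix.mul_assoc, hε, Matrix.mul_one, ← Matrix.mul_assoc, hε,
      Matrix.one_mul]
  conv_rhs => rw [← h1]
  rfl

theorem frameMatrix_mul {q : Type*} (ε : Fin n → Matrix (Fin (n * p)) (Fin p) ℂ)
    (Y : Matrix (Fin n × Fin p) q ℂ) :
    frameMatrix ε * Y = ∑ l, ε l * Y.submatrix (fun i => (l, i)) id := by
  ext a j
  rw [Matrix.mul_apply, Fintype.sum_prod_type, Matrix.sum_apply]
  rfl

theorem conjTranspose_frameMatrix_mul_apply {q : Type*}
    (ε : Fin n → Matrix (Fin (n * p)) (Fin p) ℂ) (f : Matrix (Fin (n * p)) q ℂ) (l : Fin n)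
    (i : Fin p) (j : q) : ((frameMatrix ε)ᴴ * f) (l, i) j = ((ε l)ᴴ * f) i j := rfl

end Neretin

/-! ### Deformed Verblunsky coefficients as corners of `Ξ`. -/

section Main

variable {n p : ℕ} {U : Matrix (Fin (n * p)) (Fin (n * p)) ℂ} {e : Matrix (Fin (n * p)) (Fin p) ℂ}
  (S : SzegoSystem (spectralMeasure U e) n)

theorem SzegoSystem.isOrthoPair (hU : Uᴴ * U = 1) {k : ℕ} (hk : k < n) :
    IsOrthoPair U e k (S.phiR k) (reversed k (S.phiL k)) :=
  isOrthoPair_of_isMOPUC hU S.right S.left hk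

theorem frameMatrix_gramSchmidtFrame (hU : Uᴴ * U = 1) :
    (frameMatrix (gramSchmidtFrame U e S))ᴴ * frameMatrix (gramSchmidtFrame U e S) = 1 := by
  ext ⟨k, i⟩ ⟨l, j⟩
  have h := S.right.orthonormal k k.2 l l.2
  rw [innerR_spectralMeasure e hU] at h
  have h1 : ((gramSchmidtFrame U e S k)ᴴ * gramSchmidtFrame U e S l) i j = _ :=
    congrFun (congrFun h i) j
  refine h1.trans ?_
  by_cases hkl : k = l
  · subst hkl; simp [Matrix.one_apply]
  · rw [if_neg (fun h => hkl (Fin.ext h)), Matrix.one_apply_ne (by simp [hkl])]; rfl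

/-- A kernel element, padded by zeros, is the coordinate matrix of a frame `x = F(U)e` with `deg F <
k` and `x†(Ux - x) = 0`, so `F = 0`. -/
theorem isUnit_one_sub_toBlock (hp : 1 ≤ p) (he : IsCyclicFrame n p U e) (hU : Uᴴ * U = 1)
    (k : Fin n) :
    IsUnit (1 - (matrixInBasis (gramSchmidtFrame U e S) U).toBlock
      (InFirst (k : ℕ)) (InFirst (k : ℕ))) := by
  set ε := gramSchmidtFrame U e S with hε
  set G := matrixInBasis ε U with hG
  -- Injectivity on vectors is tested on matrices with `p` columns, which needs at least one column.
  have : Nonempty (Fin p) := ⟨⟨0, hp⟩⟩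
  rw [← Matrix.mulVec_injective_iff_isUnit,
    ← Matrix.mul_right_injective_iff_mulVec_injective (n := Fin p)]
  suffices key : ∀ V : Matrix {x : Fin n × Fin p // InFirst (k : ℕ) x} (Fin p) ℂ,
      (1 - G.toBlock (InFirst (k : ℕ)) (InFirst (k : ℕ))) * V = 0 → V = 0 from
    fun V V' h => sub_eq_zero.mp (key _ (by rw [Matrix.mul_sub]; exact sub_eq_zero.mpr h))
  intro V hV
  let Y : Matrix (Fin n × Fin p) (Fin p) ℂ :=
    Matrix.of fun y j => if h : InFirst (k : ℕ) y then V ⟨y, h⟩ j else 0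
  have hYin : blockRows (InFirst (k : ℕ)) Y = V := by
    ext y j; exact dif_pos y.2
  have hYout : blockRows (fun x => ¬ InFirst (k : ℕ) x) Y = 0 := by
    ext y j; exact dif_neg y.2
  have hEE := frameMatrix_gramSchmidtFrame S hU
  let F : (Matrix (Fin p) (Fin p) ℂ)[X] :=
    ∑ l : Fin n, S.phiR l * C (Y.submatrix (fun i => (l, i)) id)
  have hF : F.degree < ((k : ℕ) : WithBot ℕ) := by
    rw [← Polynomial.mem_degreeLT]
    refine Submodule.sum_mem _ fun l _ => ?_
    rw [Polynomial.mem_degreeLT]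
    by_cases hl : l < k
    · exact degree_lt_mono (degree_mul_C_lt (S.isOrthoPair hU l.2).degree_R _) hl
    · have h0 : Y.submatrix (fun i => (l, i)) id = 0 := by
        ext i j
        exact dif_neg hl
      rw [h0, C_0, mul_zero, Polynomial.degree_zero]
      exact WithBot.bot_lt_coe _
  have hx : applyFrame U e F = frameMatrix ε * Y := by
    rw [frameMatrix_mul, applyFrame_sum]
    exact Finset.sum_congr rfl fun l _ => applyFrame_mul_C U e _ _
  have hGY : (frameMatrix ε)ᴴ * (U * (frameMatrix ε * Y)) = G * Y := by
    rw [hG, matrixInBasis]; simp only [Matrix.mul_assoc]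
  have hF0 : F = 0 := by
    refine he.eq_zero_of_inner_eq hU k.2 hF ?_
    rw [hx, Matrix.conjTranspose_mul, Matrix.mul_assoc, Matrix.mul_sub, hGY, ← Matrix.mul_assoc _ _ Y,
      hEE, Matrix.one_mul]
    ext i j
    rw [Matrix.mul_apply, Matrix.zero_apply]
    refine Finset.sum_eq_zero fun y _ => ?_
    by_cases hy : InFirst (k : ℕ) y
    · have h1 := toBlock_mul_blockRows (k : ℕ) (InFirst (k : ℕ)) G Y
      rw [hYin, hYout, Matrix.mul_zero, add_zero] at h1
      rw [Matrix.sub_mul, Matrix.one_mul, h1, ← hYin] at hV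
      have h2 := congrFun (congrFun hV ⟨y, hy⟩) j
      have h3 : (G * Y - Y) y j = 0 := by
        rw [Matrix.sub_apply, ← neg_sub, neg_eq_zero]; exact h2
      rw [h3, mul_zero]
    · have h1 : Y y i = 0 := dif_neg hy
      rw [Matrix.conjTranspose_apply, h1, star_zero, zero_mul]
  rw [hF0, applyFrame_zero] at hx
  rw [← hYin, ← Matrix.one_mul Y, ← hEE, Matrix.mul_assoc, ← hx, Matrix.mul_zero]
  rfl

/-- Treats the last index together with the others: `T` is the `φ_{k+1}` term, or zero when `k = n -
1`. Only its orthogonality is needed later. -/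
theorem SzegoSystem.exists_recursion (hU : Uᴴ * U = 1) {k : ℕ} (hk : k < n) :
    ∃ T : Matrix (Fin (n * p)) (Fin p) ℂ, (∀ j < k + 1, (U ^ j * e)ᴴ * T = 0) ∧
      U * applyFrame U e (S.phiR k)
        = T + applyFrame U e (reversed k (S.phiL k)) * (S.alpha k)ᴴ := by
  rcases (Nat.succ_le_of_lt hk).lt_or_eq with hk' | hk'
  · refine ⟨applyFrame U e (S.phiR (k + 1)) * rhoR (S.alpha k), fun j hj => ?_, ?_⟩
    · rw [← Matrix.mul_assoc, (S.isOrthoPair hU hk').orth_R j hj, Matrix.zero_mul]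
    · have h := congrArg (applyFrame U e) (S.verblunsky.szegoR k hk')
      rw [applyFrame_sub, applyFrame_X_mul, applyFrame_mul_C _ _ _ (rhoR _),
        applyFrame_mul_C _ _ _ (S.alpha k)ᴴ, sub_eq_iff_eq_add'] at h
      exact h
  · refine ⟨0, fun j _ => Matrix.mul_zero _, ?_⟩
    have h := S.verblunsky.last_szegoR k hk'
    rw [innerR_spectralMeasure e hU, Matrix.conjTranspose_mul_self_eq_zero, applyFrame_sub,
      applyFrame_X_mul, applyFrame_mul_C _ _ _ (S.alpha k)ᴴ, sub_eq_zero] at h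
    rw [zero_add]
    exact h

theorem SzegoSystem.evalAt_reversed_phiR (hU : Uᴴ * U = 1) {k : ℕ} (hk : k < n) :
    evalAt (reversed k (S.phiR k)) 1 = ((S.phiR k).eval 1)ᴴ := by
  rw [evalAt_one, eval_one_reversed (S.isOrthoPair hU hk).degree_R]

theorem SzegoSystem.evalAt_phiL {k : ℕ} (hk : k < n) :
    evalAt (S.phiL k) 1 = ((reversed k (S.phiL k)).eval 1)ᴴ := by
  have h : (S.phiL k).degree < ((k + 1 : ℕ) : WithBot ℕ) :=
    degree_C_mul_lt (degree_lt_succ_of_monic (S.left.monic k hk)) _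
  rw [evalAt_one, eval_one_reversed h, Matrix.conjTranspose_conjTranspose]

theorem SzegoSystem.b_eq (hU : Uᴴ * U = 1) {k : ℕ} (hk : k < n) :
    S.b k = (((S.phiR k).eval 1)⁻¹ * (reversed k (S.phiL k)).eval 1)ᴴ := by
  rw [SzegoSystem.b, S.evalAt_reversed_phiR hU hk, S.evalAt_phiL hk, Matrix.conjTranspose_mul,
    Matrix.conjTranspose_nonsing_inv]

theorem SzegoSystem.gamma_eq (he : IsCyclicFrame n p U e) (hU : Uᴴ * U = 1) {k : ℕ} (hk : k < n) :
    S.gamma k = ((S.phiR k).eval 1)⁻¹ * (reversed k (S.phiL k)).eval 1 * (S.alpha k)ᴴ := by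
  rw [SzegoSystem.gamma, S.b_eq hU hk, Matrix.inv_eq_right_inv
    ((S.isOrthoPair hU hk).unitary_eval he hU hk)]

theorem neretinBlock_eq_gamma (hp : 1 ≤ p) (he : IsCyclicFrame n p U e) (hU : Uᴴ * U = 1)
    (k : Fin n) : neretinBlock k (matrixInBasis (gramSchmidtFrame U e S) U) = S.gamma k := by
  have hunit := isUnit_one_sub_toBlock S hp he hU k
  have hEE := frameMatrix_gramSchmidtFrame S hU
  have hEE' : frameMatrix (gramSchmidtFrame U e S) * (frameMatrix (gramSchmidtFrame U e S))ᴴ = 1 :=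
    (Matrix.mul_eq_one_comm_of_card_eq _ _ _ (by simp)).mp hEE
  have hpair := S.isOrthoPair hU k.2
  obtain ⟨q, hq, hRq⟩ := hpair.exists_interpolation he hU k.2
  obtain ⟨T, hT, hUR⟩ := S.exists_recursion hU k.2
  rw [S.gamma_eq he hU k.2]
  set ε := gramSchmidtFrame U e S with hε
  set G := matrixInBasis ε U with hG
  set W := ((S.phiR k).eval 1)⁻¹ * (reversed k (S.phiL k)).eval 1
  have hεk : ∀ l : Fin n, ε l = applyFrame U e (S.phiR l) := fun _ => rfl
  rw [← hεk] at hRq hUR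
  set x := applyFrame U e (q * C (S.alpha k)ᴴ) with hx
  -- The test frame: adding `x` to `ε k` cancels the term `Ux` produced when `Q(U)e` is rewritten
  -- through `ε k * W`.
  have hUy : U * (x + ε k) = x + ε k * (W * (S.alpha k)ᴴ) + T := by
    rw [Matrix.mul_add, hUR, ← Matrix.mul_assoc (ε k), hRq, hx, applyFrame_mul_C, Matrix.add_mul,
      Matrix.sub_mul, Matrix.mul_assoc U]
    abel
  have hdiag : (ε k)ᴴ * ε k = 1 := hpair.norm_R
  have hlow : ∀ l : Fin n, l < k → (ε l)ᴴ * ε k = 0 := fun l hl =>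
    applyFrame_orthogonal hpair.orth_R (degree_lt_mono (S.isOrthoPair hU l.2).degree_R hl)
  have hlowT : ∀ l : Fin n, l ≤ k → (ε l)ᴴ * T = 0 := fun l hl =>
    applyFrame_orthogonal hT (degree_lt_mono (S.isOrthoPair hU l.2).degree_R (Nat.succ_le_succ hl))
  have hhigh : ∀ l : Fin n, k ≤ l → (ε l)ᴴ * x = 0 := fun l hl =>
    conjTranspose_mul_eq_zero_comm (applyFrame_orthogonal (S.isOrthoPair hU l.2).orth_R
      (degree_lt_mono (degree_mul_C_lt hq _) hl))
  set Y := (frameMatrix ε)ᴴ * (x + ε k) with hY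
  have hGY : G * Y = (frameMatrix ε)ᴴ * (x + ε k * (W * (S.alpha k)ᴴ) + T) := by
    rw [← hUy, hG, matrixInBasis, hY, Matrix.mul_assoc, ← Matrix.mul_assoc (frameMatrix ε), hEE',
      Matrix.one_mul, Matrix.mul_assoc]
  have hN := neretin_mul (k : ℕ) (M := G) (Y := Y) hunit (by
    ext ⟨⟨l, i⟩, hl⟩ j
    rw [blockRows_apply, blockRows_apply, hGY, hY, conjTranspose_frameMatrix_mul_apply,
      conjTranspose_frameMatrix_mul_apply, Matrix.mul_add, Matrix.mul_add, Matrix.mul_add,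
      hlowT l (le_of_lt hl), ← Matrix.mul_assoc _ (ε k), hlow l hl, Matrix.zero_mul, add_zero])
  ext i j
  have h1 := congrFun (congrFun hN ⟨(k, i), lt_irrefl (k : ℕ)⟩) j
  rw [blockRows_apply, hGY, conjTranspose_frameMatrix_mul_apply, Matrix.mul_add,
    Matrix.mul_add, hhigh k le_rfl, hlowT k le_rfl, ← Matrix.mul_assoc _ (ε k), hdiag,
    Matrix.one_mul, add_zero, zero_add] at h1
  -- Below the first `k` blocks the coordinates of `x + ε k` are an identity in block `k` and zero
  -- after it, so the product in `h1` picks out the corner of `Ξ`.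
  refine Eq.trans ?_ h1
  symm
  rw [Matrix.mul_apply, Finset.sum_eq_single ⟨(k, j), lt_irrefl (k : ℕ)⟩]
  · rw [blockRows_apply, hY, conjTranspose_frameMatrix_mul_apply, Matrix.mul_add,
      hhigh k le_rfl, hdiag, zero_add, Matrix.one_apply_eq, mul_one]
    rfl
  · rintro ⟨⟨l, i'⟩, hl⟩ _ hne
    have hkl : k ≤ l := not_lt.mp hl
    rw [blockRows_apply, hY, conjTranspose_frameMatrix_mul_apply, Matrix.mul_add,
      hhigh l hkl, zero_add]
    rcases hkl.eq_or_lt with rfl | hkl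
    · rw [hdiag, Matrix.one_apply_ne, mul_zero]
      rintro rfl
      exact hne rfl
    · have h2 : (ε l)ᴴ * ε k = 0 := conjTranspose_mul_eq_zero_comm
        (applyFrame_orthogonal (S.isOrthoPair hU l.2).orth_R
          (degree_lt_mono hpair.degree_R hkl))
      rw [h2, Matrix.zero_apply, mul_zero]
  · exact fun h => absurd (Finset.mem_univ _) h

end Main

end BlockGGT

theorem proposition6p3 (n p : ℕ) (hn : 1 ≤ n) (hp : 1 ≤ p)
    (U : Matrix (Fin (n * p)) (Fin (n * p)) ℂ) (hU : U ∈ Matrix.unitaryGroup (Fin (n * p)) ℂ)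
    (e : Matrix (Fin (n * p)) (Fin p) ℂ) (he : IsCyclicFrame n p U e) :
    Nonempty (SzegoSystem (spectralMeasure U e) n) ∧
    ∀ (S : SzegoSystem (spectralMeasure U e) n)
      (ε : Fin n → Matrix (Fin (n * p)) (Fin p) ℂ), ε = gramSchmidtFrame U e S →
      ∀ (G : Matrix (Fin n × Fin p) (Fin n × Fin p) ℂ), G = matrixInBasis ε U →
      ∀ k : Fin n,
        IsUnit (1 - G.toBlock (InFirst (k : ℕ)) (InFirst (k : ℕ))) ∧
        IsUnit (evalAt (reversed (k : ℕ) (S.phiR k)) 1) ∧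
        IsUnit (S.b k) ∧
        neretinBlock k G
          = pseudoInner (ε k) (operatorOfMatrix ε (reflection (k : ℕ) G) * ε k) ∧
        pseudoInner (ε k) (operatorOfMatrix ε (reflection (k : ℕ) G) * ε k) = S.gamma k := by
  have hU' : Uᴴ * U = 1 := Matrix.mem_unitaryGroup_iff'.mp hU
  refine ⟨nonempty_szegoSystem he hU', ?_⟩
  rintro S ε rfl G rfl k
  have hpair := S.isOrthoPair hU' k.2
  have hinner : neretinBlock k (matrixInBasis (gramSchmidtFrame U e S) U)
      = pseudoInner (gramSchmidtFrame U e S k) (operatorOfMatrix (gramSchmidtFrame U e S)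
        (reflection (k : ℕ) (matrixInBasis (gramSchmidtFrame U e S) U))
          * gramSchmidtFrame U e S k) := by
    ext i j
    rw [pseudoInner_operatorOfMatrix (frameMatrix_gramSchmidtFrame S hU'), reflection_apply]
  refine ⟨isUnit_one_sub_toBlock S hp he hU' k, ?_, ?_, hinner,
    hinner ▸ neretinBlock_eq_gamma S hp he hU' k⟩
  · rw [S.evalAt_reversed_phiR hU' k.2, Matrix.isUnit_conjTranspose]
    exact hpair.isUnit_eval_R he hU' k.2
  · rw [S.b_eq hU' k.2, Matrix.isUnit_conjTranspose]
    exact isUnit_of_left_inv (hpair.unitary_eval he hU' k.2)
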